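/- Let $M$ be a smooth $3$-dimensional manifold with a pseudo-Riemannian metric $g$ (of arbitrary signature) with Levi-Civita connection $\nabla$, let $\varepsilon\in\{1,-1\}$, and let $(\varphi,\xi,\eta)$ be a smooth $(1,1)$-tensor field, a smooth vector field and a smooth $1$-form on $M$ such that $$\varphi^2=-I+\eta\otimes\xi,\quad \eta(\xi)=1,\quad \varphi\xi=0,\quad \eta\circ\varphi=0,\quad g(\varphi X,\varphi Y)=g(X,Y)-\varepsilon\,\eta(X)\eta(Y),$$ and such that the structure is Kenmotsu, i.e. for all vector fields $X,Y$ $$(\nabla_X\varphi)Y=-\eta(Y)\,\varphi X-\varepsilon\, g(X,\varphi Y)\,\xi .$$ Write $R(X,Y)=[\nabla_X,\nabla_Y]-\nabla_{[X,Y]}$ for the curvature tensor and $\mathrm{Ric}(Y,Z)=\operatorname{tr}\bigl(X\mapsto R(X,Y)Z\bigr)$ for the Ricci tensor. Suppose that $(g,V)$ is a Ricci soliton: $V$ is a smooth vector field on $M$ and there is a real constant $\lambda$ such that $$(\mathcal L_V g)(X,Y)+2\,\mathrm{Ric}(X,Y)+2\lambda\, g(X,Y)=0\quad\text{for all vector fields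 } X,Y .$$ Then $(M,g)$ is of constant curvature $-\varepsilon$, i.e. $$R(X,Y)Z=-\varepsilon\,\{g(Y,Z)X-g(X,Z)Y\}\quad\text{for all } X,Y,Z;$$ in particular, the sectional curvature of every nondegenerate tangent plane is $-\varepsilon$. -/

import Mathlib

open Bundle Set FiberBundle VectorField
open scoped Manifold ContDiff Topology

noncomputable section

/-- A smooth pseudo-Riemannian metric on a manifold `M`: a smooth field of symmetric nondegenerate
bilinear forms (of arbitrary signature) on the tangent spaces. -/
structure PseudoRiemannianMetric
    {E : Type*} [NormedAddCommGroup E] [NormedSpace ℝ E] {H : Type*} [TopologicalSpace H]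
    (I : ModelWithCorners ℝ E H) (M : Type*) [TopologicalSpace M] [ChartedSpace H M]
    [IsManifold I ∞ M] where
  /-- The bilinear form `g x (u, v)` on the tangent space at `x`. -/
  val : ∀ x : M, TangentSpace I x →L[ℝ] TangentSpace I x →L[ℝ] ℝ
  symm : ∀ (x : M) (u v : TangentSpace I x), val x u v = val x v u
  nondegenerate : ∀ (x : M) (u : TangentSpace I x), (∀ v, val x u v = 0) → u = 0
  contMDiff : ContMDiff I (I.prod 𝓘(ℝ, E →L[ℝ] E →L[ℝ] ℝ)) ∞
    (fun x ↦ TotalSpace.mk' (E →L[ℝ] E →L[ℝ] ℝ) x (val x))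

namespace PseudoRiemannianMetric

variable {E : Type*} [NormedAddCommGroup E] [NormedSpace ℝ E]
  {H : Type*} [TopologicalSpace H] {I : ModelWithCorners ℝ E H}
  {M : Type*} [TopologicalSpace M] [ChartedSpace H M] [IsManifold I ∞ M]
  (g : PseudoRiemannianMetric I M)

lemma mdifferentiableAt_val {X Y : ∀ x : M, TangentSpace I x} {x : M}
    (hX : MDiffAt (T% X) x) (hY : MDiffAt (T% Y) x) :
    MDiffAt (fun y ↦ g.val y (X y) (Y y)) x := by
  have hg : MDifferentiableAt I (I.prod 𝓘(ℝ, E →L[ℝ] E →L[ℝ] ℝ))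
      (fun y ↦ TotalSpace.mk' (E →L[ℝ] E →L[ℝ] ℝ) y (g.val y)) x :=
    (g.contMDiff x).mdifferentiableAt (by simp)
  have h : MDifferentiableAt I (I.prod 𝓘(ℝ))
      (fun y ↦ TotalSpace.mk' ℝ (E := Bundle.Trivial M ℝ) y (g.val y (X y) (Y y))) x :=
    hg.clm_bundle_apply₂ (F₁ := E) (F₂ := E) hX hY
  simp only [mdifferentiableAt_totalSpace] at h
  exact h.2

/-- The Koszul expression
`X g(Y, Z) + Y g(Z, X) - Z g(X, Y) + g([X, Y], Z) - g([Y, Z], X) + g([Z, X], Y)` at `x`,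
which equals `2 g(∇_X Y, Z)` for the Levi-Civita connection `∇` of `g`. -/
def koszul (Y X Z : ∀ x : M, TangentSpace I x) (x : M) : ℝ :=
  mvfderiv I (fun y ↦ g.val y (Y y) (Z y)) x (X x)
    + mvfderiv I (fun y ↦ g.val y (Z y) (X y)) x (Y x)
    - mvfderiv I (fun y ↦ g.val y (X y) (Y y)) x (Z x)
    + g.val x (mlieBracket I X Y x) (Z x)
    - g.val x (mlieBracket I Y Z x) (X x)
    + g.val x (mlieBracket I Z X x) (Y x)

lemma mvfderiv_val_add_left {X X' Y : ∀ x : M, TangentSpace I x} {x : M}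
    (hX : MDiffAt (T% X) x) (hX' : MDiffAt (T% X') x) (hY : MDiffAt (T% Y) x) :
    mvfderiv I (fun y ↦ g.val y ((X + X') y) (Y y)) x =
      mvfderiv I (fun y ↦ g.val y (X y) (Y y)) x
        + mvfderiv I (fun y ↦ g.val y (X' y) (Y y)) x := by
  rw [← mvfderiv_add (g.mdifferentiableAt_val hX hY) (g.mdifferentiableAt_val hX' hY)]
  congr 1
  ext y
  simp

lemma mvfderiv_val_smul_left {f : M → ℝ} {X Y : ∀ x : M, TangentSpace I x} {x : M}
    (hf : MDiffAt f x) (hX : MDiffAt (T% X) x) (hY : MDiffAt (T% Y) x) :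
    mvfderiv I (fun y ↦ g.val y ((f • X) y) (Y y)) x =
      f x • mvfderiv I (fun y ↦ g.val y (X y) (Y y)) x
        + g.val x (X x) (Y x) • mvfderiv I f x := by
  rw [← mvfderiv_mul hf (g.mdifferentiableAt_val hX hY)]
  congr 1
  ext y
  simp

lemma mvfderiv_val_comm (X Y : ∀ x : M, TangentSpace I x) (x : M) :
    mvfderiv I (fun y ↦ g.val y (X y) (Y y)) x = mvfderiv I (fun y ↦ g.val y (Y y) (X y)) x := by
  congr 1
  ext y
  exact g.symm y _ _

lemma mvfderiv_val_add_right {X Y Y' : ∀ x : M, TangentSpace I x} {x : M}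
    (hX : MDiffAt (T% X) x) (hY : MDiffAt (T% Y) x) (hY' : MDiffAt (T% Y') x) :
    mvfderiv I (fun y ↦ g.val y (X y) ((Y + Y') y)) x =
      mvfderiv I (fun y ↦ g.val y (X y) (Y y)) x
        + mvfderiv I (fun y ↦ g.val y (X y) (Y' y)) x := by
  rw [g.mvfderiv_val_comm X, g.mvfderiv_val_comm X, g.mvfderiv_val_comm X,
    g.mvfderiv_val_add_left hY hY' hX]

lemma mvfderiv_val_smul_right {f : M → ℝ} {X Y : ∀ x : M, TangentSpace I x} {x : M}
    (hf : MDiffAt f x) (hX : MDiffAt (T% X) x) (hY : MDiffAt (T% Y) x) :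
    mvfderiv I (fun y ↦ g.val y (X y) ((f • Y) y)) x =
      f x • mvfderiv I (fun y ↦ g.val y (X y) (Y y)) x
        + g.val x (X x) (Y x) • mvfderiv I f x := by
  rw [g.mvfderiv_val_comm X, g.mvfderiv_val_comm X, g.mvfderiv_val_smul_left hf hY hX,
    g.symm x (X x)]

lemma ext_of_val {x : M} {u u' : TangentSpace I x} (h : ∀ v, g.val x u v = g.val x u' v) :
    u = u' :=
  sub_eq_zero.1 <| g.nondegenerate x _ fun v ↦ by simp [h]

variable [FiniteDimensional ℝ E]

lemma tensorialAt_koszul_left {Y Z : ∀ x : M, TangentSpace I x} {x : M}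
    (hY : MDiffAt (T% Y) x) (hZ : MDiffAt (T% Z) x) :
    TensorialAt I E (fun X ↦ g.koszul Y X Z x) x where
  smul {f X} hf hX := by
    simp only [koszul, mlieBracket_smul_left hf hX, mlieBracket_smul_right hf hX,
      g.mvfderiv_val_smul_left hf hX hY, g.mvfderiv_val_smul_right hf hZ hX]
    simp [g.symm x (X x)]
    ring
  add {X X'} hX hX' := by
    simp only [koszul, mlieBracket_add_left hX hX', mlieBracket_add_right hX hX',
      g.mvfderiv_val_add_left hX hX' hY, g.mvfderiv_val_add_right hZ hX hX']
    simp
    ring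

lemma tensorialAt_koszul_right {Y X : ∀ x : M, TangentSpace I x} {x : M}
    (hY : MDiffAt (T% Y) x) (hX : MDiffAt (T% X) x) :
    TensorialAt I E (fun Z ↦ g.koszul Y X Z x) x where
  smul {f Z} hf hZ := by
    simp only [koszul, mlieBracket_smul_left hf hZ, mlieBracket_smul_right hf hZ,
      g.mvfderiv_val_smul_left hf hZ hX, g.mvfderiv_val_smul_right hf hY hZ]
    simp [g.symm x (Z x)]
    ring
  add {Z Z'} hZ hZ' := by
    simp only [koszul, mlieBracket_add_left hZ hZ', mlieBracket_add_right hZ hZ',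
      g.mvfderiv_val_add_left hZ hZ' hX, g.mvfderiv_val_add_right hY hZ hZ']
    simp
    ring

open scoped Classical in
/-- The Koszul expression as a bilinear form in the values of `X` and `Z` at `x`
(by convention `0` if `Y` is not differentiable at `x`). -/
def koszulHom (Y : ∀ x : M, TangentSpace I x) (x : M) :
    TangentSpace I x →L[ℝ] TangentSpace I x →L[ℝ] ℝ :=
  if hY : MDiffAt (T% Y) x then
    TensorialAt.mkHom₂ (fun X Z ↦ g.koszul Y X Z x) x
      (fun _ hZ ↦ g.tensorialAt_koszul_left hY hZ) (fun _ hX ↦ g.tensorialAt_koszul_right hY hX)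
  else 0

lemma koszulHom_apply {X Y Z : ∀ x : M, TangentSpace I x} {x : M} (hX : MDiffAt (T% X) x)
    (hY : MDiffAt (T% Y) x) (hZ : MDiffAt (T% Z) x) :
    g.koszulHom Y x (X x) (Z x) = g.koszul Y X Z x := by
  rw [koszulHom, dif_pos hY, TensorialAt.mkHom₂_apply _ _ hX hZ]

instance (x : M) : FiniteDimensional ℝ (TangentSpace I x) :=
  inferInstanceAs (FiniteDimensional ℝ E)

instance (x : M) : T2Space (TangentSpace I x) := inferInstanceAs (T2Space E)

/-- The musical isomorphism `u ↦ g(u, ·)` at a point. -/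
def flat (x : M) : TangentSpace I x ≃ₗ[ℝ] (TangentSpace I x →L[ℝ] ℝ) :=
  LinearEquiv.ofBijective (g.val x : TangentSpace I x →ₗ[ℝ] (TangentSpace I x →L[ℝ] ℝ)) <| by
    have hinj : Function.Injective
        (g.val x : TangentSpace I x →ₗ[ℝ] (TangentSpace I x →L[ℝ] ℝ)) := by
      rw [injective_iff_map_eq_zero]
      intro u hu
      exact g.nondegenerate x u fun v ↦ congrArg (fun α : TangentSpace I x →L[ℝ] ℝ ↦ α v) hu
    let e : (TangentSpace I x →ₗ[ℝ] ℝ) ≃ₗ[ℝ] (TangentSpace I x →L[ℝ] ℝ) :=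
      LinearMap.toContinuousLinearMap
    have hrank : Module.finrank ℝ (TangentSpace I x) =
        Module.finrank ℝ (TangentSpace I x →L[ℝ] ℝ) := by
      rw [← e.finrank_eq]
      exact (Subspace.dual_finrank_eq (K := ℝ) (V := TangentSpace I x)).symm
    have : FiniteDimensional ℝ (TangentSpace I x →L[ℝ] ℝ) := e.finiteDimensional
    exact ⟨hinj, (LinearMap.injective_iff_surjective_of_finrank_eq_finrank hrank).1 hinj⟩

lemma val_flat_symm (x : M) (α : TangentSpace I x →L[ℝ] ℝ) (v : TangentSpace I x) :
    g.val x ((g.flat x).symm α) v = α v :=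
  congrArg (fun β : TangentSpace I x →L[ℝ] ℝ ↦ β v) ((g.flat x).apply_symm_apply α)

/-- The covariant derivative `u ↦ ∇_u Y` of a vector field `Y` at `x`, determined by the Koszul
formula `2 g(∇_X Y, Z) = koszul`. -/
def leviCivitaAux (Y : ∀ x : M, TangentSpace I x) (x : M) :
    TangentSpace I x →L[ℝ] TangentSpace I x :=
  LinearMap.toContinuousLinearMap
    ((1 / 2 : ℝ) • ((g.flat x).symm : (TangentSpace I x →L[ℝ] ℝ) →ₗ[ℝ] TangentSpace I x) ∘ₗ
      (g.koszulHom Y x : TangentSpace I x →ₗ[ℝ] (TangentSpace I x →L[ℝ] ℝ)))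

lemma val_leviCivitaAux {X Y Z : ∀ x : M, TangentSpace I x} {x : M} (hX : MDiffAt (T% X) x)
    (hY : MDiffAt (T% Y) x) (hZ : MDiffAt (T% Z) x) :
    g.val x (g.leviCivitaAux Y x (X x)) (Z x) = 1 / 2 * g.koszul Y X Z x := by
  rw [← g.koszulHom_apply hX hY hZ, ← g.val_flat_symm x (g.koszulHom Y x (X x))]
  simp [leviCivitaAux]

lemma leviCivitaAux_ext {Y : ∀ x : M, TangentSpace I x} {x : M} (hY : MDiffAt (T% Y) x)
    {A : TangentSpace I x →L[ℝ] TangentSpace I x}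
    (h : ∀ X Z : ∀ x : M, TangentSpace I x, MDiffAt (T% X) x → MDiffAt (T% Z) x →
      1 / 2 * g.koszul Y X Z x = g.val x (A (X x)) (Z x)) :
    g.leviCivitaAux Y x = A := by
  ext u
  refine g.ext_of_val fun v ↦ ?_
  have hu := mdifferentiableAt_extend I E u
  have hv := mdifferentiableAt_extend I E v
  have := h _ _ hu hv
  rw [← g.val_leviCivitaAux hu hY hv] at this
  simpa using this

/-- The Levi-Civita connection of a pseudo-Riemannian metric, defined by the Koszul formula;
`g.leviCivita Y x (X x)` is `∇_X Y` at `x`. -/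
def leviCivita : CovariantDerivative I E (TangentSpace I : M → Type _) where
  toFun := g.leviCivitaAux
  isCovariantDerivativeOnUniv :=
    { add := fun {Y Y' x} hY hY' _ ↦ by
        refine g.leviCivitaAux_ext (mdifferentiableAt_add_section hY hY') fun X Z hX hZ ↦ ?_
        rw [ContinuousLinearMap.add_apply, map_add, ContinuousLinearMap.add_apply,
          g.val_leviCivitaAux hX hY hZ, g.val_leviCivitaAux hX hY' hZ]
        simp only [koszul, mlieBracket_add_left hY hY', mlieBracket_add_right hY hY',
          g.mvfderiv_val_add_left hY hY' hZ, g.mvfderiv_val_add_right hX hY hY']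
        simp
        ring
      leibniz := fun {Y f x} hY hf _ ↦ by
        refine g.leviCivitaAux_ext (hf.smul_section hY) fun X Z hX hZ ↦ ?_
        rw [ContinuousLinearMap.add_apply, map_add, ContinuousLinearMap.add_apply,
          ContinuousLinearMap.smul_apply, map_smul, ContinuousLinearMap.smul_apply,
          g.val_leviCivitaAux hX hY hZ]
        simp only [koszul, mlieBracket_smul_left hf hY, mlieBracket_smul_right hf hY,
          g.mvfderiv_val_smul_left hf hY hZ, g.mvfderiv_val_smul_right hf hX hY]
        simp [g.symm x (Y x)]
        ring }

lemma val_leviCivita {X Y Z : ∀ x : M, TangentSpace I x} {x : M} (hX : MDiffAt (T% X) x)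
    (hY : MDiffAt (T% Y) x) (hZ : MDiffAt (T% Z) x) :
    g.val x (g.leviCivita Y x (X x)) (Z x) = 1 / 2 * g.koszul Y X Z x :=
  g.val_leviCivitaAux hX hY hZ

/-- The Levi-Civita connection is torsion-free. -/
theorem leviCivita_torsion : g.leviCivita.torsion = 0 := by
  rw [CovariantDerivative.torsion_eq_zero_iff]
  intro X Y x hX hY
  refine g.ext_of_val fun v ↦ ?_
  have hv := mdifferentiableAt_extend I E v
  have h₁ := g.val_leviCivita hX hY hv
  have h₂ := g.val_leviCivita hY hX hv
  rw [extend_apply_self] at h₁ h₂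
  rw [map_sub, ContinuousLinearMap.sub_apply, h₁, h₂]
  simp only [koszul]
  rw [g.mvfderiv_val_comm Y X, g.mvfderiv_val_comm (extend E v) X,
    g.mvfderiv_val_comm Y (extend E v), mlieBracket_swap_apply (V := Y) (W := X),
    mlieBracket_swap_apply (V := extend E v) (W := X),
    mlieBracket_swap_apply (V := Y) (W := extend E v)]
  simp
  ring

/-- The Levi-Civita connection is compatible with the metric. -/
theorem mvfderiv_val {X Y : ∀ x : M, TangentSpace I x} {x : M} (hX : MDiffAt (T% X) x)
    (hY : MDiffAt (T% Y) x) (u : TangentSpace I x) :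
    mvfderiv I (fun y ↦ g.val y (X y) (Y y)) x u =
      g.val x (g.leviCivita X x u) (Y x) + g.val x (X x) (g.leviCivita Y x u) := by
  have hu := mdifferentiableAt_extend I E u
  have h₁ := g.val_leviCivita hu hX hY
  have h₂ := g.val_leviCivita hu hY hX
  rw [extend_apply_self] at h₁ h₂
  rw [g.symm x (X x), h₁, h₂]
  simp only [koszul]
  rw [g.mvfderiv_val_comm Y X, g.mvfderiv_val_comm (extend E u) X,
    g.mvfderiv_val_comm Y (extend E u), mlieBracket_swap_apply (V := Y) (W := X),
    mlieBracket_swap_apply (V := X) (W := extend E u),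
    mlieBracket_swap_apply (V := Y) (W := extend E u)]
  simp
  ring

/-- The curvature `R(X, Y) Z = ∇_X ∇_Y Z - ∇_Y ∇_X Z - ∇_[X, Y] Z` of vector fields. -/
def curvatureField (X Y Z : ∀ x : M, TangentSpace I x) (x : M) : TangentSpace I x :=
  g.leviCivita (fun y ↦ g.leviCivita Z y (Y y)) x (X x)
    - g.leviCivita (fun y ↦ g.leviCivita Z y (X y)) x (Y x)
    - g.leviCivita Z x (mlieBracket I X Y x)

/-- The Riemann curvature tensor `R(u, v) w` at the point `x`: as `R` is tensorial, it may be
computed from any extension of `u`, `v`, `w` to vector fields that are smooth near `x`. -/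
def curvature (x : M) (u v w : TangentSpace I x) : TangentSpace I x :=
  g.curvatureField (extend E u) (extend E v) (extend E w) x

/-- The Ricci tensor `Ric(v, w)`, the trace of `u ↦ R(u, v) w`. -/
def ricci (x : M) (v w : TangentSpace I x) : ℝ :=
  ∑ i, (Module.finBasis ℝ (TangentSpace I x)).coord i
    (g.curvature x (Module.finBasis ℝ (TangentSpace I x) i) v w)

/-- The sectional curvature of the plane spanned by `u` and `v`; meaningful if the plane is
nondegenerate, i.e. if the denominator does not vanish. -/
def sectionalCurvature (x : M) (u v : TangentSpace I x) : ℝ :=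
  g.val x (g.curvature x u v v) u / (g.val x u u * g.val x v v - g.val x u v ^ 2)

/-- `(M, g)` is of constant curvature `κ`: `R(u, v) w = κ (g(v, w) u - g(u, w) v)`. -/
def HasConstantCurvature (κ : ℝ) : Prop :=
  ∀ (x : M) (u v w : TangentSpace I x),
    g.curvature x u v w = κ • (g.val x v w • u - g.val x u w • v)

/-- The Lie derivative `(L_V g)(X, Y) = V g(X, Y) - g([V, X], Y) - g(X, [V, Y])`. -/
def lieDerivative (V X Y : ∀ x : M, TangentSpace I x) (x : M) : ℝ :=
  mvfderiv I (fun y ↦ g.val y (X y) (Y y)) x (V x)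
    - g.val x (mlieBracket I V X x) (Y x) - g.val x (X x) (mlieBracket I V Y x)

/-- `(g, V)` is a Ricci soliton with constant `l`: `V` is a smooth vector field and
`L_V g + 2 Ric + 2 l g = 0`. -/
structure IsRicciSoliton (V : ∀ x : M, TangentSpace I x) (l : ℝ) : Prop where
  contMDiff : ContMDiff I I.tangent ∞ (fun x ↦ (⟨x, V x⟩ : TangentBundle I M))
  eq : ∀ (X Y : ∀ x : M, TangentSpace I x) (x : M), MDiffAt (T% X) x → MDiffAt (T% Y) x →
    g.lieDerivative V X Y x + 2 * g.ricci x (X x) (Y x) + 2 * l * g.val x (X x) (Y x) = 0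

end PseudoRiemannianMetric

/-- An almost contact pseudo-metric structure `(φ, ξ, η)` on `(M, g)` with sign `ε = ±1`:
`φ² = -I + η ⊗ ξ`, `η(ξ) = 1`, `φ ξ = 0`, `η ∘ φ = 0` and
`g(φ X, φ Y) = g(X, Y) - ε η(X) η(Y)`. -/
structure AlmostContactPseudoMetricStructure
    {E : Type*} [NormedAddCommGroup E] [NormedSpace ℝ E] {H : Type*} [TopologicalSpace H]
    {I : ModelWithCorners ℝ E H} {M : Type*} [TopologicalSpace M] [ChartedSpace H M]
    [IsManifold I ∞ M] (g : PseudoRiemannianMetric I M) (ε : ℝ) where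
  /-- The `(1, 1)`-tensor field. -/
  φ : ∀ x : M, TangentSpace I x →L[ℝ] TangentSpace I x
  /-- The Reeb vector field. -/
  ξ : ∀ x : M, TangentSpace I x
  /-- The `1`-form. -/
  η : ∀ x : M, TangentSpace I x →L[ℝ] ℝ
  contMDiff_φ : ContMDiff I (I.prod 𝓘(ℝ, E →L[ℝ] E)) ∞
    (fun x ↦ TotalSpace.mk' (E →L[ℝ] E)
      (E := fun x : M ↦ TangentSpace I x →L[ℝ] TangentSpace I x) x (φ x))
  contMDiff_ξ : ContMDiff I I.tangent ∞ (fun x ↦ (⟨x, ξ x⟩ : TangentBundle I M))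
  contMDiff_η : ContMDiff I (I.prod 𝓘(ℝ, E →L[ℝ] ℝ)) ∞
    (fun x ↦ TotalSpace.mk' (E →L[ℝ] ℝ)
      (E := fun x : M ↦ TangentSpace I x →L[ℝ] Bundle.Trivial M ℝ x) x (η x))
  sign : ε = 1 ∨ ε = -1
  φ_φ : ∀ (x : M) (u : TangentSpace I x), φ x (φ x u) = -u + η x u • ξ x
  η_ξ : ∀ x : M, η x (ξ x) = 1
  φ_ξ : ∀ x : M, φ x (ξ x) = 0
  η_φ : ∀ (x : M) (u : TangentSpace I x), η x (φ x u) = 0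
  val_φ_φ : ∀ (x : M) (u v : TangentSpace I x),
    g.val x (φ x u) (φ x v) = g.val x u v - ε * η x u * η x v

/-- The structure is Kenmotsu: `(∇_X φ) Y = -η(Y) φ X - ε g(X, φ Y) ξ`, where
`(∇_X φ) Y = ∇_X (φ Y) - φ (∇_X Y)` for the Levi-Civita connection `∇`. -/
def AlmostContactPseudoMetricStructure.IsKenmotsu
    {E : Type*} [NormedAddCommGroup E] [NormedSpace ℝ E] [FiniteDimensional ℝ E]
    {H : Type*} [TopologicalSpace H]
    {I : ModelWithCorners ℝ E H} {M : Type*} [TopologicalSpace M] [ChartedSpace H M]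
    [IsManifold I ∞ M] {g : PseudoRiemannianMetric I M} {ε : ℝ}
    (S : AlmostContactPseudoMetricStructure g ε) : Prop :=
  ∀ (X Y : ∀ x : M, TangentSpace I x) (x : M), MDiffAt (T% X) x → MDiffAt (T% Y) x →
    g.leviCivita (fun y ↦ S.φ y (Y y)) x (X x) - S.φ x (g.leviCivita Y x (X x)) =
      -(S.η x (Y x) • S.φ x (X x)) - (ε * g.val x (X x) (S.φ x (Y x))) • S.ξ x

end

/-!
Near each point the structure is described by an adapted frame `e, φ e, ξ` with `g(e, e) = δ = ±1`.
On a Kenmotsu manifold `∇_X ξ = X - η(X) ξ`, so that in dimension three the whole connection is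
determined by a single one-form `ω(X) = δ g(∇_X e, φ e)`, and the curvature tensor is
`-ε {g(Y, Z) X - g(X, Z) Y}` plus a function `f` times the area form of `ker η` on `X, Y` and the
rotation of `ker η` on `Z`. The claim is that `f = 0`.

In such a frame the soliton equation is an overdetermined linear system for the three components
`u, v, a` of `V`. Prolonging it by the derivatives `a₁, a₂` of `a` and by the rotation `α` of
`∇V` in `ker η` gives a closed system, and equating mixed derivatives yields its integrability
conditions: the soliton constant is `λ = 2ε`, the differential of `f` on `ker η` is
`(ε δ / 2) f da`, and `f` times a polynomial in the unknowns vanishes. Differentiating this last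
relation repeatedly gives `f a₁ = f a₂ = 0`, hence `f ^ 2 = 0`.
This part, `FrameEquations.curv_eq_zero_of_soliton`, is pure algebra in a reduced commutative
`ℝ`-algebra with three derivations; no positivity is used, so the signature plays no role. It has
to work with `f` as a factor throughout, since `f` may vanish at some points and not at others.

The link to geometry is `AdaptedFrame.frameEquations`, for the algebra of smooth functions on the
domain of the frame. Two facts about derivations along vector fields are needed there: that `X f` is
smooth, and that `[X, Y]` acts as a commutator. Both are read off from identities for Lie brackets
with a field `f Z`: the Leibniz rule gives the first, the Jacobi identity the second.
The curvature and Ricci tensors are then computed from the components of fields extending the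
given tangent vectors, in `AdaptedFrame.curvature_eq` and `AdaptedFrame.ricci_eq`.
-/

noncomputable section

/-! ### Calculus of vector fields on an open set -/

section VectorFieldCalculus

variable {E : Type*} [NormedAddCommGroup E] [NormedSpace ℝ E]
  {H : Type*} [TopologicalSpace H] {I : ModelWithCorners ℝ E H}
  {M : Type*} [TopologicalSpace M] [ChartedSpace H M]
  {U : Set M} {X Y Z : ∀ x : M, TangentSpace I x} {f : M → ℝ}

lemma IsOpen.mdifferentiableAt_function (hU : IsOpen U) (hf : CMDiff[U] ∞ f) {x : M}
    (hx : x ∈ U) : MDiffAt f x :=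
  (hf.contMDiffAt (hU.mem_nhds hx)).mdifferentiableAt (by simp)

variable [IsManifold I ∞ M]

lemma IsOpen.mdifferentiableAt_section (hU : IsOpen U) (hX : CMDiff[U] ∞ (T% X)) {x : M}
    (hx : x ∈ U) : MDiffAt (T% X) x :=
  (hX.contMDiffAt (hU.mem_nhds hx)).mdifferentiableAt (by simp)

lemma ContMDiffOn.oneForm_apply {η : ∀ x : M, TangentSpace I x →L[ℝ] ℝ}
    (hη : ContMDiff I (I.prod 𝓘(ℝ, E →L[ℝ] ℝ)) ∞
      (fun x ↦ TotalSpace.mk' (E →L[ℝ] ℝ)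
        (E := fun x : M ↦ TangentSpace I x →L[ℝ] Bundle.Trivial M ℝ x) x (η x)))
    (hX : CMDiff[U] ∞ (T% X)) : CMDiff[U] ∞ (fun x ↦ η x (X x)) := by
  have h : ContMDiffOn I (I.prod 𝓘(ℝ)) ∞
      (fun y ↦ TotalSpace.mk' ℝ (E := Bundle.Trivial M ℝ) y (η y (X y))) U :=
    hη.contMDiffOn.clm_bundle_apply (F₁ := E) (F₂ := ℝ) hX
  intro x hx
  have := h x hx
  simp only [contMDiffWithinAt_totalSpace] at this
  exact this.2

lemma ContMDiffOn.endomorphism_apply {φ : ∀ x : M, TangentSpace I x →L[ℝ] TangentSpace I x}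
    (hφ : ContMDiff I (I.prod 𝓘(ℝ, E →L[ℝ] E)) ∞
      (fun x ↦ TotalSpace.mk' (E →L[ℝ] E)
        (E := fun x : M ↦ TangentSpace I x →L[ℝ] TangentSpace I x) x (φ x)))
    (hX : CMDiff[U] ∞ (T% X)) : CMDiff[U] ∞ (T% (fun x ↦ φ x (X x))) :=
  hφ.contMDiffOn.clm_bundle_apply (F₁ := E) (F₂ := E) hX

lemma PseudoRiemannianMetric.contMDiffOn_val (g : PseudoRiemannianMetric I M)
    (hX : CMDiff[U] ∞ (T% X)) (hY : CMDiff[U] ∞ (T% Y)) :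
    CMDiff[U] ∞ (fun x ↦ g.val x (X x) (Y x)) := by
  have h : ContMDiffOn I (I.prod 𝓘(ℝ)) ∞
      (fun y ↦ TotalSpace.mk' ℝ (E := Bundle.Trivial M ℝ) y (g.val y (X y) (Y y))) U :=
    g.contMDiff.contMDiffOn.clm_bundle_apply₂ (F₁ := E) (F₂ := E) hX hY
  intro x hx
  have := h x hx
  simp only [contMDiffWithinAt_totalSpace] at this
  exact this.2

variable [FiniteDimensional ℝ E]

lemma ContMDiffOn.mlieBracket_of_isOpen (hU : IsOpen U) (hX : CMDiff[U] ∞ (T% X))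
    (hY : CMDiff[U] ∞ (T% Y)) : CMDiff[U] ∞ (T% (mlieBracket I X Y)) := by
  have : IsManifold I ((⊤ : ℕ∞) + 1) M := by simpa using ‹IsManifold I ∞ M›
  have : IsManifold I (minSmoothness ℝ 2) M := by
    simp only [minSmoothness_of_isRCLikeNormedField]
    exact IsManifold.of_le (n := ∞) (WithTop.coe_le_coe.2 le_top)
  intro x hx
  have h := (hX.contMDiffAt (hU.mem_nhds hx)).mlieBracket_vectorField (m := ⊤) (n := ⊤)
    (hY.contMDiffAt (hU.mem_nhds hx)) (by simp)
  exact h.contMDiffWithinAt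

/-- A vector field `X` and a function `f` satisfy `X f • Z = [X, f Z] - f [X, Z]`, so that `X f` is
smooth because Lie brackets are, as soon as some smooth one-form does not vanish on some `Z`. -/
lemma ContMDiffOn.mvfderiv_apply_of_oneForm (hU : IsOpen U)
    {η : ∀ x : M, TangentSpace I x →L[ℝ] ℝ}
    (hη : ContMDiff I (I.prod 𝓘(ℝ, E →L[ℝ] ℝ)) ∞
      (fun x ↦ TotalSpace.mk' (E →L[ℝ] ℝ)
        (E := fun x : M ↦ TangentSpace I x →L[ℝ] Bundle.Trivial M ℝ x) x (η x)))
    (hZ : CMDiff[U] ∞ (T% Z)) (hηZ : ∀ x ∈ U, η x (Z x) = 1)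
    (hf : CMDiff[U] ∞ f) (hX : CMDiff[U] ∞ (T% X)) :
    CMDiff[U] ∞ (fun x ↦ mvfderiv I f x (X x)) := by
  have h₁ := ContMDiffOn.oneForm_apply hη
    (ContMDiffOn.mlieBracket_of_isOpen hU hX (hf.smul_section hZ))
  have h₂ := ContMDiffOn.oneForm_apply hη (ContMDiffOn.mlieBracket_of_isOpen hU hX hZ)
  refine (h₁.sub (hf.mul h₂)).congr fun x hx ↦ ?_
  have := mlieBracket_smul_right (V := X) (hU.mdifferentiableAt_function hf hx)
    (hU.mdifferentiableAt_section hZ hx)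
  simp [this, hηZ x hx]

/-- The Lie bracket acts on functions as the commutator of the two derivations. This is read off
from the Jacobi identity for `X`, `Y` and `f Z`, with `Z` a field that does not vanish at `x`. -/
lemma mvfderiv_mlieBracket (hU : IsOpen U) (hf : CMDiff[U] ∞ f) (hX : CMDiff[U] ∞ (T% X))
    (hY : CMDiff[U] ∞ (T% Y)) (hZ : CMDiff[U] ∞ (T% Z))
    (hXf : CMDiff[U] ∞ (fun x ↦ mvfderiv I f x (X x)))
    (hYf : CMDiff[U] ∞ (fun x ↦ mvfderiv I f x (Y x))) {x : M} (hx : x ∈ U) (hZx : Z x ≠ 0) :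
    mvfderiv I f x (mlieBracket I X Y x) =
      mvfderiv I (fun y ↦ mvfderiv I f y (Y y)) x (X x)
        - mvfderiv I (fun y ↦ mvfderiv I f y (X y)) x (Y x) := by
  have : IsManifold I (minSmoothness ℝ 3) M := by
    simp only [minSmoothness_of_isRCLikeNormedField]
    exact IsManifold.of_le (n := ∞) (WithTop.coe_le_coe.2 le_top)
  have cd {W : ∀ x : M, TangentSpace I x} (hW : CMDiff[U] ∞ (T% W)) :
      CMDiffAt (minSmoothness ℝ 2) (T% W) x :=
    (hW.contMDiffAt (hU.mem_nhds hx)).of_le (by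
      simp only [minSmoothness_of_isRCLikeNormedField]; exact WithTop.coe_le_coe.2 le_top)
  have sm {W : ∀ x : M, TangentSpace I x} (hW : CMDiff[U] ∞ (T% W)) {y : M} (hy : y ∈ U) :=
    hU.mdifferentiableAt_section hW hy
  have br {W W' : ∀ x : M, TangentSpace I x} (hW : CMDiff[U] ∞ (T% W))
    (hW' : CMDiff[U] ∞ (T% W')) := ContMDiffOn.mlieBracket_of_isOpen hU hW hW'
  have fn {h : M → ℝ} (hh : CMDiff[U] ∞ h) := hU.mdifferentiableAt_function hh hx
  have J := leibniz_identity_mlieBracket_apply (cd hX) (cd hY) (cd hZ)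
  have Jf := leibniz_identity_mlieBracket_apply (cd hX) (cd hY) (cd (hf.smul_section hZ))
  -- near `x`, the bracket of `W` with `f Z` is given by the Leibniz rule
  have key {W W' : ∀ x : M, TangentSpace I x} (hW' : CMDiff[U] ∞ (T% W'))
      (hW'f : CMDiff[U] ∞ (fun x ↦ mvfderiv I f x (W' x))) :
      mlieBracket I W (mlieBracket I W' (f • Z)) x =
        mvfderiv I (fun y ↦ mvfderiv I f y (W' y)) x (W x) • Z x
          + mvfderiv I f x (W' x) • mlieBracket I W Z x
          + (mvfderiv I f x (W x) • mlieBracket I W' Z x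
            + f x • mlieBracket I W (mlieBracket I W' Z) x) := by
    have hev : mlieBracket I W' (f • Z) =ᶠ[𝓝 x]
        ((fun y ↦ mvfderiv I f y (W' y)) • Z + f • mlieBracket I W' Z :
          ∀ x : M, TangentSpace I x) := by
      filter_upwards [hU.mem_nhds hx] with y hy
      exact mlieBracket_smul_right (hU.mdifferentiableAt_function hf hy) (sm hZ hy)
    rw [(Filter.EventuallyEq.refl _ W).mlieBracket_vectorField_eq hev,
      mlieBracket_add_right (sm (hW'f.smul_section hZ) hx)
        (sm (hf.smul_section (br hW' hZ)) hx),
      mlieBracket_smul_right (fn hW'f) (sm hZ hx),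
      mlieBracket_smul_right (fn hf) (sm (br hW' hZ) hx)]
  rw [key hY hYf, key hX hXf, mlieBracket_smul_right (fn hf) (sm hZ hx), J] at Jf
  have h0 : (mvfderiv I f x (mlieBracket I X Y x)
      - (mvfderiv I (fun y ↦ mvfderiv I f y (Y y)) x (X x)
        - mvfderiv I (fun y ↦ mvfderiv I f y (X y)) x (Y x))) • Z x = 0 := by
    rw [← sub_eq_zero] at Jf
    rw [← neg_eq_zero, ← Jf]
    module
  exact sub_eq_zero.1 ((smul_eq_zero.1 h0).resolve_right hZx)

end VectorFieldCalculus

/-! ### The structure equations of an adapted frame -/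

section FrameAlgebra

set_option linter.unusedSimpArgs false

variable {A : Type*} [CommRing A] [Algebra ℝ A] {D₁ D₂ D₃ : Derivation ℝ A A}
  {p q s σ δ f : A}

lemma eq_zero_of_ofNat_mul_eq_zero {n : ℕ} [n.AtLeastTwo] {x : A}
    (h : (OfNat.ofNat n : A) * x = 0) : x = 0 := by
  have h' : algebraMap ℝ A ((OfNat.ofNat n : ℝ)⁻¹ * OfNat.ofNat n) * x = 0 := by
    rw [map_mul, mul_assoc, map_ofNat, h, mul_zero]
  rwa [inv_mul_cancel₀ (NeZero.ne _), map_one, one_mul] at h'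

lemma Derivation.map_ofNat_eq_zero (D : Derivation ℝ A A) (n : ℕ) [n.AtLeastTwo] :
    D (ofNat(n) : A) = 0 := by
  rw [← Nat.cast_ofNat]
  exact D.map_natCast n

variable (D₁ D₂ D₃ p q s σ δ f) in
/-- The structure equations of an adapted frame `e₁, e₂ = φ e₁, e₃ = ξ` with
`g(e₁, e₁) = g(e₂, e₂) = δ` on a three-dimensional Kenmotsu manifold, in the ring of functions:
`D₁, D₂, D₃` are the derivations along the frame, `p, q, s` are the values on the frame of the
connection form `X ↦ δ g(∇_X e₁, e₂)`, `σ = ε δ`, and `f` is, up to the sign `δ`, the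
excess of the sectional curvature of `ker η` over `-ε`. -/
structure FrameEquations : Prop where
  sq_σ : σ * σ = 1
  sq_δ : δ * δ = 1
  σ₁ : D₁ σ = 0
  σ₂ : D₂ σ = 0
  σ₃ : D₃ σ = 0
  δ₁ : D₁ δ = 0
  δ₂ : D₂ δ = 0
  δ₃ : D₃ δ = 0
  comm₁₂ : ∀ h, D₁ (D₂ h) - D₂ (D₁ h) = -(p * D₁ h) - q * D₂ h
  comm₁₃ : ∀ h, D₁ (D₃ h) - D₃ (D₁ h) = D₁ h - s * D₂ h
  comm₂₃ : ∀ h, D₂ (D₃ h) - D₃ (D₂ h) = D₂ h + s * D₁ h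
  curv : D₂ p - D₁ q - p * p - q * q = f
  D₃p : D₃ p = D₁ s - p + s * q
  D₃q : D₃ q = D₂ s - q - s * p

namespace FrameEquations

variable (h : FrameEquations D₁ D₂ D₃ p q s σ δ f)
include h

/-- The second Bianchi identity for the remaining curvature function. -/
lemma D₃_curv : D₃ f = -(2 * f) := by
  have h1 := h.comm₁₃ q
  have h2 := h.comm₂₃ p
  have h3 := h.comm₁₂ s
  rw [h.D₃p] at h2
  rw [h.D₃q] at h1
  simp only [← h.curv, map_sub, Derivation.leibniz, smul_eq_mul, map_add] at *
  rw [h.D₃p, h.D₃q]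
  linear_combination h1 - h2 - h3

variable {u v a m : A}

/-- The integrability conditions of the soliton equation for `V = u e₁ + v e₂ + a ξ`. Prolonging
by the rotation `α` of `∇V` in the plane `ker η` and by the derivatives `a₁, a₂` of `a` closes the
system; comparing mixed derivatives yields first `m = 0`, the differential of `f`, and then
algebraic relations, each of them multiplied by `f`, whose successive differentiation forces
`f ^ 2 = 0`. -/
theorem curv_eq_zero_of_soliton [IsReduced A] (m₁ : D₁ m = 0) (m₂ : D₂ m = 0) (m₃ : D₃ m = 0)
    (h11 : D₁ u = v * p - a + m - δ * f) (h22 : D₂ v = -(u * q) - a + m - δ * f)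
    (h12 : D₁ v + u * p + (D₂ u - v * q) = 0)
    (h13 : D₃ u = v * s + u - σ * D₁ a) (h23 : D₃ v = -(u * s) + v - σ * D₂ a)
    (h33 : D₃ a = m) : f = 0 := by
  have hf₃ := h.D₃_curv
  have hp := h.D₃p
  have hq := h.D₃q
  have hc := h.curv
  have hσ := h.sq_σ
  have hδ := h.sq_δ
  have hσ1 := h.σ₁
  have hσ2 := h.σ₂
  have hσ3 := h.σ₃
  have hδ1 := h.δ₁
  have hδ2 := h.δ₂
  have hδ3 := h.δ₃
  obtain ⟨α, hα⟩ : ∃ α, α = D₁ v + u * p := ⟨_, rfl⟩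
  obtain ⟨a₁, ha₁⟩ : ∃ x, x = D₁ a := ⟨_, rfl⟩
  obtain ⟨a₂, ha₂⟩ : ∃ x, x = D₂ a := ⟨_, rfl⟩
  have h1v : D₁ v = α - u * p := by linear_combination -hα
  have h2u : D₂ u = v * q - α := by linear_combination h12 + hα
  rw [← ha₁] at h13
  rw [← ha₂] at h23
  have d3a1 : D₃ a₁ = -a₁ + s * a₂ := by
    have := h.comm₁₃ a
    rw [h33, m₁, ← ha₁, ← ha₂] at this
    linear_combination -this
  have d3a2 : D₃ a₂ = -a₂ - s * a₁ := by
    have := h.comm₂₃ a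
    rw [h33, m₂, ← ha₁, ← ha₂] at this
    linear_combination -this
  have hsym : D₁ a₂ - D₂ a₁ = -(p * a₁) - q * a₂ := by
    have := h.comm₁₂ a
    rwa [← ha₁, ← ha₂] at this
  -- The Hessian of `a` in the directions of `ker η` comes from the commutators with `D₃`.
  have e13u := h.comm₁₃ u
  rw [h13, h11] at e13u
  simp only [map_sub, map_add, map_neg, Derivation.leibniz, smul_eq_mul, ← ha₁, ← ha₂, h11, h22,
    h1v, h2u, h13, h23, h33, m₁, m₂, m₃, hσ1, hσ2, hσ3, hδ1, hδ2, hδ3, hf₃, hp, hq] at e13u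
  have d1a1 : D₁ a₁ = p * a₂ + σ * (m - 2 * δ * f) := by
    linear_combination -σ * e13u - (D₁ a₁ - p * a₂) * hσ
  have e23v := h.comm₂₃ v
  rw [h23, h22] at e23v
  simp only [map_sub, map_add, map_neg, Derivation.leibniz, smul_eq_mul, ← ha₁, ← ha₂, h11, h22,
    h1v, h2u, h13, h23, h33, m₁, m₂, m₃, hσ1, hσ2, hσ3, hδ1, hδ2, hδ3, hf₃, hp, hq] at e23v
  have d2a2 : D₂ a₂ = -(q * a₁) + σ * (m - 2 * δ * f) := by
    linear_combination -σ * e23v - (D₂ a₂ + q * a₁) * hσ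
  have e23u := h.comm₂₃ u
  rw [h13, h2u] at e23u
  simp only [map_sub, map_add, map_neg, Derivation.leibniz, smul_eq_mul, ← ha₁, ← ha₂, h11, h22,
    h1v, h2u, h13, h23, h33, m₁, m₂, m₃, hσ1, hσ2, hσ3, hδ1, hδ2, hδ3, hf₃, hp, hq] at e23u
  have e13v := h.comm₁₃ v
  rw [h23, h1v] at e13v
  simp only [map_sub, map_add, map_neg, Derivation.leibniz, smul_eq_mul, ← ha₁, ← ha₂, h11, h22,
    h1v, h2u, h13, h23, h33, m₁, m₂, m₃, hσ1, hσ2, hσ3, hδ1, hδ2, hδ3, hf₃, hp, hq] at e13v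
  have d2a1 : D₂ a₁ = q * a₂ := by
    have : 2 * (D₂ a₁ - q * a₂) = 0 := by
      linear_combination -σ * (e23u + e13v) - (D₂ a₁ + D₁ a₂ - q * a₂ + p * a₁) * hσ - hsym
    exact sub_eq_zero.1 (eq_zero_of_ofNat_mul_eq_zero this)
  have d1a2 : D₁ a₂ = -(p * a₁) := by linear_combination hsym + d2a1
  have d3α : D₃ α = 0 := by linear_combination e23u + σ * d2a1
  have hm : m = 0 := by
    have e := h.comm₁₃ a₁
    rw [d3a1, d1a1, d2a1] at e
    simp only [map_sub, map_add, map_neg, Derivation.leibniz, smul_eq_mul, d1a1, d2a1, d1a2, d2a2,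
      d3a1, d3a2, m₁, m₂, m₃, hσ1, hσ2, hσ3, hδ1, hδ2, hδ3, hf₃, hp, hq,
      Derivation.map_ofNat_eq_zero] at e
    have : 2 * m = 0 := by
      linear_combination -σ * e - 2 * m * hσ
    exact eq_zero_of_ofNat_mul_eq_zero this
  subst hm
  simp only [add_zero, zero_sub] at h11 h22 d1a1 d2a2
  -- The differential of `f` is the integrability condition of the equations for `a₁` and `a₂`.
  have d2f : 2 * D₂ f = σ * δ * f * a₂ := by
    have e := h.comm₁₂ a₁
    rw [d1a1, d2a1] at e
    simp only [map_sub, map_add, map_neg, Derivation.leibniz, smul_eq_mul, d1a1, d2a1, d1a2, d2a2,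
      hσ1, hσ2, hδ1, hδ2, Derivation.map_ofNat_eq_zero] at e
    linear_combination σ * δ * e + σ * δ * a₂ * hc - 2 * D₂ f * hσ - 2 * D₂ f * σ * σ * hδ
  have d1f : 2 * D₁ f = σ * δ * f * a₁ := by
    have e := h.comm₁₂ a₂
    rw [d1a2, d2a2] at e
    simp only [map_sub, map_add, map_neg, Derivation.leibniz, smul_eq_mul, d1a1, d2a1, d1a2, d2a2,
      hσ1, hσ2, hδ1, hδ2, Derivation.map_ofNat_eq_zero] at e
    linear_combination -σ * δ * e + σ * δ * a₁ * hc - 2 * D₁ f * hσ - 2 * D₁ f * σ * σ * hδ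
  -- The commutator of `D₁` and `D₂` on `u` and `v` closes the system with the derivatives of `α`.
  have d1α : 2 * D₁ α = 2 * a₂ + σ * f * a₂ - 2 * v * f := by
    have e := h.comm₁₂ u
    rw [h11, h2u] at e
    simp only [map_sub, map_add, map_neg, Derivation.leibniz, smul_eq_mul, h11, h22, h1v, h2u,
      ← ha₁, ← ha₂, hδ1, hδ2] at e
    linear_combination -2 * e - 2 * v * hc + δ * d2f + σ * f * a₂ * hδ
  have d2α : 2 * D₂ α = -(2 * a₁) - σ * f * a₁ + 2 * u * f := by
    have e := h.comm₁₂ v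
    rw [h22, h1v] at e
    simp only [map_sub, map_add, map_neg, Derivation.leibniz, smul_eq_mul, h11, h22, h1v, h2u,
      ← ha₁, ← ha₂, hδ1, hδ2] at e
    linear_combination -2 * e + 2 * u * hc - δ * d1f - σ * f * a₁ * hδ
  obtain ⟨N, hN⟩ : ∃ N, N = a₁ * a₁ + a₂ * a₂ := ⟨_, rfl⟩
  have d1N : D₁ N = -(4 * σ * δ * f * a₁) := by
    rw [hN]
    simp only [map_add, Derivation.leibniz, smul_eq_mul, d1a1, d1a2]
    ring
  have d2N : D₂ N = -(4 * σ * δ * f * a₂) := by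
    rw [hN]
    simp only [map_add, Derivation.leibniz, smul_eq_mul, d2a1, d2a2]
    ring
  -- The integrability condition for `α` is `f * Q = 0`.
  obtain ⟨Q, hQ⟩ : ∃ Q, Q = 2 * (u * a₁ + v * a₂) - σ * N - 8 * σ * δ * a + 16 := ⟨_, rfl⟩
  clear e13u e23v e23u e13v hsym h12 m₁ m₂ m₃ h13 h23 hα h33 d3α d3a1 d3a2 hp hq hf₃
  have fQ : f * Q = 0 := by
    have e := h.comm₁₂ α
    have e1 := congrArg D₁ d2α
    have e2 := congrArg D₂ d1α
    simp only [map_sub, map_add, map_neg, Derivation.leibniz, smul_eq_mul, h11, h22, h1v, h2u,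
      hσ1, hσ2, hδ1, hδ2, d1a1, d2a1, d1a2, d2a2, Derivation.map_ofNat_eq_zero] at e1 e2
    have e' : 16 * σ * δ * f - δ * f * N - 8 * a * f + 2 * σ * δ * f * (u * a₁ + v * a₂) = 0 := by
      linear_combination 4 * e - 2 * e1 + 2 * e2 - 2 * p * d1α - 2 * q * d2α
        - (2 * u - a₁ * σ) * d1f - (2 * v - a₂ * σ) * d2f
        + (δ * f * (a₁ * a₁ + a₂ * a₂) - 8 * δ * f * f) * hσ - δ * f * hN
    linear_combination σ * δ * e' + f * hQ
      - (16 * f + 2 * f * (u * a₁ + v * a₂)) * (δ * δ * hσ + hδ) + σ * f * N * hδ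
  have fD₁Q : f * ((2 * δ * f - 2 * a - 8 * σ * δ) * a₁ - 4 * σ * δ * u * f + 2 * α * a₂) = 0 := by
    have e := congrArg D₁ fQ
    rw [hQ] at e
    simp only [map_sub, map_add, map_neg, map_zero, Derivation.leibniz, smul_eq_mul, h11, h22, h1v,
      h2u, hσ1, hσ2, hδ1, hδ2, d1a1, d2a1, d1a2, d2a2, d1N, ← ha₁, ← ha₂,
      Derivation.map_ofNat_eq_zero] at e
    refine eq_zero_of_ofNat_mul_eq_zero (n := 2) ?_
    linear_combination 2 * e - (2 * (u * a₁ + v * a₂) - σ * N - 8 * σ * δ * a + 16) * d1f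
      - σ * δ * a₁ * (fQ - f * hQ) - 8 * δ * f * f * a₁ * hσ
  have fD₂Q : f * ((2 * δ * f - 2 * a - 8 * σ * δ) * a₂ - 4 * σ * δ * v * f - 2 * α * a₁) = 0 := by
    have e := congrArg D₂ fQ
    rw [hQ] at e
    simp only [map_sub, map_add, map_neg, map_zero, Derivation.leibniz, smul_eq_mul, h11, h22, h1v,
      h2u, hσ1, hσ2, hδ1, hδ2, d1a1, d2a1, d1a2, d2a2, d2N, ← ha₁, ← ha₂,
      Derivation.map_ofNat_eq_zero] at e
    refine eq_zero_of_ofNat_mul_eq_zero (n := 2) ?_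
    linear_combination 2 * e - (2 * (u * a₁ + v * a₂) - σ * N - 8 * σ * δ * a + 16) * d2f
      - σ * δ * a₂ * (fQ - f * hQ) - 8 * δ * f * f * a₂ * hσ
  -- Contracting with `a₁, a₂` eliminates `α`, and `f * Q = 0` then eliminates `u` and `v`.
  have fP : f * ((a + 4 * σ * δ) * N + 8 * f * (a - 2 * σ * δ)) = 0 := by
    refine eq_zero_of_ofNat_mul_eq_zero (n := 2) ?_
    linear_combination -a₁ * fD₁Q - a₂ * fD₂Q - 2 * σ * δ * f * (fQ - f * hQ)
      - 2 * δ * f * f * N * hσ - 16 * a * f * f * (δ * δ * hσ + hδ)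
      - f * (2 * δ * f - 2 * a - 8 * σ * δ) * hN
  -- Differentiating `fP` and reducing modulo `fP` leaves a relation between `a₁, a₂` and `f` alone.
  have key {D : Derivation ℝ A A} {x : A} (Dσ : D σ = 0) (Dδ : D δ = 0) (Da : x = D a)
      (Df : 2 * D f = σ * δ * f * x) (DN : D N = -(4 * σ * δ * f * x)) :
      f * x * (N - 16 * f) = 0 := by
    have e := congrArg D fP
    simp only [map_sub, map_add, map_neg, map_zero, Derivation.leibniz, smul_eq_mul,
      Dσ, Dδ, DN, ← Da, Derivation.map_ofNat_eq_zero] at e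
    refine eq_zero_of_ofNat_mul_eq_zero (n := 2) ?_
    linear_combination 2 * e
      - ((a + 4 * σ * δ) * N + 8 * f * (a - 2 * σ * δ) + 8 * f * (a - 2 * σ * δ)) * Df
      - σ * δ * x * fP + 48 * f * f * x * (δ * δ * hσ + hδ)
  have key₁ := key hσ1 hδ1 ha₁ d1f d1N
  have key₂ := key hσ2 hδ2 ha₂ d2f d2N
  have keyN : f * N * (N - 16 * f) = 0 := by
    linear_combination a₁ * key₁ + a₂ * key₂ + f * (N - 16 * f) * hN
  -- One more derivative separates the factor `N - 16 * f` into `f ^ 2 * x * N = 0` and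
  -- `f ^ 3 * x = 0`, which suffices in a reduced ring.
  have f_mul_eq_zero {D : Derivation ℝ A A} {x : A} (Df : 2 * D f = σ * δ * f * x)
      (DN : D N = -(4 * σ * δ * f * x)) (hx : f * x * (N - 16 * f) = 0) : f * x = 0 := by
    have e := congrArg D keyN
    simp only [map_sub, map_zero, Derivation.leibniz, smul_eq_mul, DN,
      Derivation.map_ofNat_eq_zero] at e
    have e2 : 24 * (f * f * x * N) = 0 := by
      linear_combination -σ * δ * (2 * e - (N * (N - 16 * f) - 16 * f * N) * Df
        - σ * δ * x * keyN + 8 * σ * δ * f * hx) - 24 * f * f * x * N * (δ * δ * hσ + hδ)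
    have e3 := eq_zero_of_ofNat_mul_eq_zero e2
    have e4 : 16 * (f * f * f * x) = 0 := by
      linear_combination e3 - f * hx
    have e5 := eq_zero_of_ofNat_mul_eq_zero e4
    exact pow_eq_zero_iff (n := 3) (by simp) |>.1 (by linear_combination x ^ 2 * e5)
  have fa₁ := f_mul_eq_zero d1f d1N key₁
  have fa₂ := f_mul_eq_zero d2f d2N key₂
  -- The Hessian of `a` contains `f`, so that the derivative of `f * a₁ = 0` contains `f ^ 2`.
  have e := congrArg D₁ fa₁
  simp only [map_zero, Derivation.leibniz, smul_eq_mul, d1a1] at e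
  have e2 : 4 * (f * f) = 0 := by
    linear_combination -σ * δ * (2 * e - a₁ * d1f - 2 * p * fa₂ - σ * δ * a₁ * fa₁)
      - 4 * f * f * (δ * δ * hσ + hδ)
  have e3 := eq_zero_of_ofNat_mul_eq_zero e2
  exact pow_eq_zero_iff (n := 2) (by simp) |>.1 (by linear_combination e3)

end FrameEquations

variable (D₁ D₂ D₃ p q s σ) in
/-- The components, in an adapted frame, of the covariant derivative `∇_X Z` of the fields with
components `x` and `z`. The frame satisfies
`∇_X e₁ = ω(X) e₂ - ε g(X, e₁) ξ`, `∇_X e₂ = -ω(X) e₁ - ε g(X, e₂) ξ`, `∇_X ξ = X - η(X) ξ`,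
where the one-form `ω` has the values `p, q, s` on the frame. -/
def frameNabla (x z : Fin 3 → A) : Fin 3 → A :=
  ![x 0 * D₁ (z 0) + x 1 * D₂ (z 0) + x 2 * D₃ (z 0) - z 1 * (x 0 * p + x 1 * q + x 2 * s)
      + z 2 * x 0,
    x 0 * D₁ (z 1) + x 1 * D₂ (z 1) + x 2 * D₃ (z 1) + z 0 * (x 0 * p + x 1 * q + x 2 * s)
      + z 2 * x 1,
    x 0 * D₁ (z 2) + x 1 * D₂ (z 2) + x 2 * D₃ (z 2) - σ * (x 0 * z 0 + x 1 * z 1)]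

/-- The curvature of the connection `frameNabla`, as a consequence of the structure equations: that
of a space of constant curvature, up to a multiple `f` of the curvature of a surface. -/
theorem FrameEquations.frameNabla_curvature (h : FrameEquations D₁ D₂ D₃ p q s σ δ f)
    (x y z : Fin 3 → A) :
    let N := frameNabla D₁ D₂ D₃ p q s σ
    N x (N y z) - N y (N x z) - N (N x y - N y x) z =
      (σ * (x 0 * z 0 + x 1 * z 1) + x 2 * z 2) • y - (σ * (y 0 * z 0 + y 1 * z 1) + y 2 * z 2) • x
        + (f * (x 0 * y 1 - x 1 * y 0)) • ![z 1, -z 0, 0] := by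
  have hσ1 := h.σ₁
  have hσ2 := h.σ₂
  have hσ3 := h.σ₃
  intro N
  funext k
  fin_cases k
  · simp only [N, frameNabla, Pi.sub_apply, Pi.add_apply, Pi.smul_apply, Matrix.cons_val,
      Fin.zero_eta, map_sub, map_add, Derivation.leibniz, smul_eq_mul, hσ1, hσ2, hσ3, h.D₃p, h.D₃q]
    linear_combination (x 0 * y 1 - x 1 * y 0) * (h.comm₁₂ (z 0) + z 1 * h.curv)
      + (x 0 * y 2 - x 2 * y 0) * h.comm₁₃ (z 0) + (x 1 * y 2 - x 2 * y 1) * h.comm₂₃ (z 0)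
  · simp only [N, frameNabla, Pi.sub_apply, Pi.add_apply, Pi.smul_apply, Matrix.cons_val,
      Fin.mk_one, map_sub, map_add, Derivation.leibniz, smul_eq_mul, hσ1, hσ2, hσ3, h.D₃p, h.D₃q]
    linear_combination (x 0 * y 1 - x 1 * y 0) * (h.comm₁₂ (z 1) - z 0 * h.curv)
      + (x 0 * y 2 - x 2 * y 0) * h.comm₁₃ (z 1) + (x 1 * y 2 - x 2 * y 1) * h.comm₂₃ (z 1)
  · simp only [N, frameNabla, Pi.sub_apply, Pi.add_apply, Pi.smul_apply, Matrix.cons_val,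
      Fin.reduceFinMk, map_sub, map_add, Derivation.leibniz, smul_eq_mul, hσ1, hσ2, hσ3]
    linear_combination (x 0 * y 1 - x 1 * y 0) * h.comm₁₂ (z 2)
      + (x 0 * y 2 - x 2 * y 0) * h.comm₁₃ (z 2) + (x 1 * y 2 - x 2 * y 1) * h.comm₂₃ (z 2)

end FrameAlgebra

/-! ### Derivations of the algebra of smooth functions on an open set -/

section SmoothFunctions

variable {E : Type*} [NormedAddCommGroup E] [NormedSpace ℝ E]
  {H : Type*} [TopologicalSpace H] {I : ModelWithCorners ℝ E H}
  {M : Type*} [TopologicalSpace M] [ChartedSpace H M] {U : Set M}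

variable (I U) in
/-- The algebra of the functions on `U` that are restrictions of functions on `M` which are smooth
on `U`. -/
def smoothFunctions : Subalgebra ℝ (U → ℝ) where
  carrier := {f | ∃ F : M → ℝ, CMDiff[U] ∞ F ∧ ∀ x : U, F x = f x}
  mul_mem' := by
    rintro _ _ ⟨F, hF, h⟩ ⟨G, hG, h'⟩
    exact ⟨F * G, hF.mul hG, fun x ↦ by simp [h, h']⟩
  add_mem' := by
    rintro _ _ ⟨F, hF, h⟩ ⟨G, hG, h'⟩
    exact ⟨F + G, hF.add hG, fun x ↦ by simp [h, h']⟩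
  algebraMap_mem' r := ⟨fun _ ↦ r, contMDiffOn_const, fun _ ↦ rfl⟩

namespace smoothFunctions

/-- The restriction to `U` of a function that is smooth on `U`. -/
def restrict (F : M → ℝ) (hF : CMDiff[U] ∞ F) : smoothFunctions I U :=
  ⟨fun x ↦ F x, F, hF, fun _ ↦ rfl⟩

/-- An extension to `M` of an element of `smoothFunctions I U`; its values off `U` are irrelevant. -/
def lift (f : smoothFunctions I U) : M → ℝ := f.2.choose

lemma contMDiffOn_lift (f : smoothFunctions I U) : CMDiff[U] ∞ (lift f) := f.2.choose_spec.1

@[simp] lemma lift_apply (f : smoothFunctions I U) (x : U) : lift f x = f.1 x :=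
  f.2.choose_spec.2 x

lemma lift_of_mem (f : smoothFunctions I U) {x : M} (hx : x ∈ U) : lift f x = f.1 ⟨x, hx⟩ :=
  (lift_apply f) ⟨x, hx⟩

@[simp] lemma restrict_apply (F : M → ℝ) (hF : CMDiff[U] ∞ F) (x : U) :
    (restrict (I := I) F hF).1 x = F x := rfl

instance : IsReduced (smoothFunctions I U) :=
  isReduced_of_injective (smoothFunctions I U).val Subtype.val_injective

lemma mvfderiv_congr (hU : IsOpen U) {F G : M → ℝ} (h : EqOn F G U) {x : M} (hx : x ∈ U) :
    mvfderiv I F x = mvfderiv I G x := by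
  have h' : F =ᶠ[𝓝 x] G := h.eventuallyEq_of_mem (hU.mem_nhds hx)
  ext v
  simp only [mvfderiv, h'.mfderiv_eq]
  rw [h'.eq_of_nhds]

/-- The derivation `f ↦ X f` of `smoothFunctions I U`, for a field `X` that maps smooth functions
to smooth functions. -/
def derivation (hU : IsOpen U) (X : ∀ x : M, TangentSpace I x)
    (hX : ∀ F : M → ℝ, CMDiff[U] ∞ F → CMDiff[U] ∞ (fun x ↦ mvfderiv I F x (X x))) :
    Derivation ℝ (smoothFunctions I U) (smoothFunctions I U) where
  toFun f := restrict (fun x ↦ mvfderiv I (lift f) x (X x)) (hX _ (contMDiffOn_lift f))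
  map_add' f g := by
    ext x
    have h : EqOn (lift (f + g)) (lift f + (lift g)) U := fun y hy ↦ by simp [lift_of_mem _ hy]
    simp only [restrict_apply, Subalgebra.coe_add, Pi.add_apply]
    rw [mvfderiv_congr hU h x.2, mvfderiv_add
      (hU.mdifferentiableAt_function (contMDiffOn_lift f) x.2)
      (hU.mdifferentiableAt_function (contMDiffOn_lift g) x.2)]
    simp
  map_smul' r f := by
    ext x
    have h : EqOn (lift (r • f)) ((fun _ ↦ r) * (lift f)) U := fun y hy ↦ by simp [lift_of_mem _ hy]
    simp only [restrict_apply, Subalgebra.coe_smul, Pi.smul_apply, RingHom.id_apply]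
    rw [mvfderiv_congr hU h x.2, mvfderiv_mul mdifferentiableAt_const
      (hU.mdifferentiableAt_function (contMDiffOn_lift f) x.2), mvfderiv_const]
    simp
  map_one_eq_zero' := by
    ext x
    have h : EqOn (lift (1 : smoothFunctions I U)) (fun _ ↦ 1) U := fun y hy ↦ by
      simp [lift_of_mem _ hy]
    simp only [LinearMap.coe_mk, AddHom.coe_mk, restrict_apply]
    rw [mvfderiv_congr hU h x.2, mvfderiv_const]
    simp
  leibniz' f g := by
    ext x
    have h : EqOn (lift (f * g)) (lift f * (lift g)) U := fun y hy ↦ by simp [lift_of_mem _ hy]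
    simp only [LinearMap.coe_mk, AddHom.coe_mk, restrict_apply, Subalgebra.coe_add,
      smul_eq_mul, Subalgebra.coe_mul, Pi.add_apply, Pi.mul_apply]
    rw [mvfderiv_congr hU h x.2, mvfderiv_mul
      (hU.mdifferentiableAt_function (contMDiffOn_lift f) x.2)
      (hU.mdifferentiableAt_function (contMDiffOn_lift g) x.2)]
    simp

lemma mvfderiv_lift (hU : IsOpen U) (f : smoothFunctions I U) {F : M → ℝ}
    (h : ∀ x (hx : x ∈ U), F x = f.1 ⟨x, hx⟩) {x : M} (hx : x ∈ U) :
    mvfderiv I (lift f) x = mvfderiv I F x :=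
  mvfderiv_congr hU (fun y hy ↦ (lift_of_mem f hy).trans (h y hy).symm) hx

end smoothFunctions

end SmoothFunctions

/-! ### Adapted frames of a Kenmotsu structure -/

section AdaptedFrames

variable {E : Type*} [NormedAddCommGroup E] [NormedSpace ℝ E]
  {H : Type*} [TopologicalSpace H] {I : ModelWithCorners ℝ E H}
  {M : Type*} [TopologicalSpace M] [ChartedSpace H M] [IsManifold I ∞ M]
  {g : PseudoRiemannianMetric I M} {ε : ℝ}

namespace AlmostContactPseudoMetricStructure

variable (S : AlmostContactPseudoMetricStructure g ε)
include S

lemma ε_mul_self : ε * ε = 1 := by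
  rcases S.sign with h | h <;> simp [h]

lemma val_ξ (x : M) (u : TangentSpace I x) : g.val x u (S.ξ x) = ε * S.η x u := by
  have h := S.val_φ_φ x u (S.ξ x)
  rw [S.φ_ξ, S.η_ξ, map_zero] at h
  linarith

lemma val_φ (x : M) (u v : TangentSpace I x) : g.val x (S.φ x u) v = -g.val x u (S.φ x v) := by
  have h := S.val_φ_φ x u (S.φ x v)
  rw [S.φ_φ, S.η_φ, map_add, map_neg, map_smul, S.val_ξ, S.η_φ] at h
  simp only [mul_zero, smul_zero, add_zero, sub_zero] at h
  linarith

lemma mdifferentiableAt_ξ (x : M) : MDiffAt (T% S.ξ) x :=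
  (S.contMDiff_ξ x).mdifferentiableAt (by simp)

variable [FiniteDimensional ℝ E] {S}

lemma IsKenmotsu.nabla_φ (hS : S.IsKenmotsu) {Y : ∀ x : M, TangentSpace I x} {x : M}
    (hY : MDiffAt (T% Y) x) (v : TangentSpace I x) :
    g.leviCivita (fun y ↦ S.φ y (Y y)) x v = S.φ x (g.leviCivita Y x v)
      - S.η x (Y x) • S.φ x v - (ε * g.val x v (S.φ x (Y x))) • S.ξ x := by
  have h := hS _ Y x (mdifferentiableAt_extend I E v) hY
  simp only [extend_apply_self] at h
  rw [sub_eq_iff_eq_add.1 h]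
  abel

/-- The Reeb field of a Kenmotsu structure satisfies `∇_v ξ = v - η(v) ξ`. -/
lemma IsKenmotsu.nabla_ξ (hS : S.IsKenmotsu) (x : M) (v : TangentSpace I x) :
    g.leviCivita S.ξ x v = v - S.η x v • S.ξ x := by
  have hξ := S.mdifferentiableAt_ξ x
  have h := hS.nabla_φ hξ v
  have h0 : (fun y ↦ S.φ y (S.ξ y)) = (0 : ∀ x : M, TangentSpace I x) := funext S.φ_ξ
  rw [h0, CovariantDerivative.zero, S.η_ξ, S.φ_ξ] at h
  simp only [Pi.zero_apply, zero_apply, map_zero, mul_zero, one_smul, zero_smul, sub_zero] at h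
  -- `∇_v ξ` is orthogonal to `ξ` because `g(ξ, ξ)` is constant
  have hη : S.η x (g.leviCivita S.ξ x v) = 0 := by
    have h1 := g.mvfderiv_val hξ hξ v
    have h2 : (fun y ↦ g.val y (S.ξ y) (S.ξ y)) = fun _ ↦ ε := by
      funext y
      rw [S.val_ξ, S.η_ξ, mul_one]
    rw [h2, mvfderiv_const, g.symm x (S.ξ x), S.val_ξ] at h1
    simp only [zero_apply] at h1
    linear_combination -(ε / 2) * h1 - S.η x (g.leviCivita S.ξ x v) * S.ε_mul_self
  have h1 := congrArg (S.φ x) (sub_eq_zero.1 h.symm)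
  rw [S.φ_φ, S.φ_φ, hη, zero_smul, add_zero] at h1
  rw [← neg_neg (g.leviCivita S.ξ x v), h1]
  abel

end AlmostContactPseudoMetricStructure

/-- A frame `e, φ e, ξ` on the open set `U` which is adapted to an almost contact pseudo-metric
structure: `e` is a smooth section of `ker η` with `g(e, e) = δ = ±1`. -/
structure AdaptedFrame (S : AlmostContactPseudoMetricStructure g ε) (U : Set M) where
  isOpen : IsOpen U
  /-- The first field of the frame. -/
  e : ∀ x : M, TangentSpace I x
  contMDiffOn_e : CMDiff[U] ∞ (T% e)
  /-- The sign `g(e, e)`. -/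
  δ : ℝ
  δ_mul_self : δ * δ = 1
  val_e : ∀ x ∈ U, g.val x (e x) (e x) = δ
  η_e : ∀ x ∈ U, S.η x (e x) = 0

namespace AdaptedFrame

variable {S : AlmostContactPseudoMetricStructure g ε} {U : Set M} (F : AdaptedFrame S U)

/-- The restriction of an adapted frame to a smaller open set. -/
def restrict {U' : Set M} (hU' : IsOpen U') (h : U' ⊆ U) : AdaptedFrame S U' where
  isOpen := hU'
  e := F.e
  contMDiffOn_e := F.contMDiffOn_e.mono h
  δ := F.δ
  δ_mul_self := F.δ_mul_self
  val_e x hx := F.val_e x (h hx)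
  η_e x hx := F.η_e x (h hx)

/-- The second field `φ e` of the frame. -/
def e' (x : M) : TangentSpace I x := S.φ x (F.e x)

lemma contMDiffOn_e' : CMDiff[U] ∞ (T% F.e') :=
  ContMDiffOn.endomorphism_apply S.contMDiff_φ F.contMDiffOn_e

lemma contMDiffOn_ξ (_F : AdaptedFrame S U) : CMDiff[U] ∞ (T% S.ξ) := S.contMDiff_ξ.contMDiffOn

lemma φ_e (x : M) : S.φ x (F.e x) = F.e' x := rfl

lemma η_e' (x : M) : S.η x (F.e' x) = 0 := S.η_φ x _

lemma φ_e' {x : M} (hx : x ∈ U) : S.φ x (F.e' x) = -F.e x := by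
  rw [e', S.φ_φ, F.η_e x hx, zero_smul, add_zero]

lemma val_e'_e' {x : M} (hx : x ∈ U) : g.val x (F.e' x) (F.e' x) = F.δ := by
  rw [e', S.val_φ_φ, F.η_e x hx, F.val_e x hx, mul_zero, sub_zero]

lemma val_e_e' (x : M) : g.val x (F.e x) (F.e' x) = 0 := by
  have h := S.val_φ x (F.e x) (F.e x)
  rw [g.symm] at h
  rw [e']
  linarith

lemma val_e'_e (x : M) : g.val x (F.e' x) (F.e x) = 0 := by rw [g.symm, F.val_e_e']

lemma val_ξ_left (_F : AdaptedFrame S U) (x : M) (u : TangentSpace I x) :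
    g.val x (S.ξ x) u = ε * S.η x u := by
  rw [g.symm, S.val_ξ]

/-- The three coordinates of a tangent vector in the frame. -/
def coord (x : M) (u : TangentSpace I x) : Fin 3 → ℝ :=
  ![F.δ * g.val x u (F.e x), F.δ * g.val x u (F.e' x), S.η x u]

/-- The tangent vector with given coordinates in the frame. -/
def comb (x : M) (c : Fin 3 → ℝ) : TangentSpace I x :=
  c 0 • F.e x + c 1 • F.e' x + c 2 • S.ξ x

@[simp] lemma coord_comb {x : M} (hx : x ∈ U) (c : Fin 3 → ℝ) : F.coord x (F.comb x c) = c := by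
  funext k
  fin_cases k <;>
  simp only [coord, comb, map_add, map_smul, add_apply, smul_apply, smul_eq_mul, F.val_e x hx,
    F.val_e_e', F.val_e'_e, F.val_e'_e' hx, F.val_ξ_left, F.η_e x hx, F.η_e', S.η_ξ, mul_zero,
    add_zero, zero_add, mul_one, Fin.zero_eta, Fin.mk_one, Fin.reduceFinMk, Matrix.cons_val]
  · linear_combination c 0 * F.δ_mul_self
  · linear_combination c 1 * F.δ_mul_self

lemma val_comb {x : M} (hx : x ∈ U) (c d : Fin 3 → ℝ) : g.val x (F.comb x c) (F.comb x d) =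
    F.δ * (c 0 * d 0 + c 1 * d 1) + ε * (c 2 * d 2) := by
  simp only [comb, map_add, map_smul, add_apply, smul_apply, smul_eq_mul, F.val_e x hx, S.val_ξ,
    F.val_e_e', F.val_e'_e, F.val_e'_e' hx, F.val_ξ_left, F.η_e x hx, F.η_e', S.η_ξ]
  ring

lemma comb_add (x : M) (c d : Fin 3 → ℝ) : F.comb x (c + d) = F.comb x c + F.comb x d := by
  simp only [comb, Pi.add_apply]
  module

lemma comb_smul (x : M) (r : ℝ) (c : Fin 3 → ℝ) : F.comb x (r • c) = r • F.comb x c := by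
  simp only [comb, Pi.smul_apply, smul_eq_mul]
  module

lemma comb_sub (x : M) (c d : Fin 3 → ℝ) : F.comb x (c - d) = F.comb x c - F.comb x d := by
  simp only [comb, Pi.sub_apply]
  module

@[simp] lemma comb_coord [FiniteDimensional ℝ E] [hE : Fact (Module.finrank ℝ E = 3)] {x : M}
    (hx : x ∈ U) (u : TangentSpace I x) : F.comb x (F.coord x u) = u := by
  let L : (Fin 3 → ℝ) →ₗ[ℝ] TangentSpace I x :=
    { toFun := F.comb x
      map_add' := F.comb_add x
      map_smul' := F.comb_smul x }
  have hL : Function.Injective L := Function.LeftInverse.injective (F.coord_comb hx)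
  have hdim : Module.finrank ℝ (Fin 3 → ℝ) = Module.finrank ℝ (TangentSpace I x) := by
    rw [Module.finrank_fin_fun]
    exact hE.out.symm
  obtain ⟨c, rfl⟩ := (LinearMap.injective_iff_surjective_of_finrank_eq_finrank hdim).1 hL u
  exact congrArg (F.comb x) (F.coord_comb hx c)

lemma contMDiffOn_coord {X : ∀ x : M, TangentSpace I x} (hX : CMDiff[U] ∞ (T% X)) (k : Fin 3) :
    CMDiff[U] ∞ (fun x ↦ F.coord x (X x) k) := by
  fin_cases k
  · exact contMDiffOn_const.mul (g.contMDiffOn_val hX F.contMDiffOn_e)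
  · exact contMDiffOn_const.mul (g.contMDiffOn_val hX F.contMDiffOn_e')
  · exact ContMDiffOn.oneForm_apply S.contMDiff_η hX

variable [FiniteDimensional ℝ E]

include F in
lemma contMDiffOn_mvfderiv {X : ∀ x : M, TangentSpace I x} (hX : CMDiff[U] ∞ (T% X)) {f : M → ℝ}
    (hf : CMDiff[U] ∞ f) : CMDiff[U] ∞ (fun x ↦ mvfderiv I f x (X x)) :=
  ContMDiffOn.mvfderiv_apply_of_oneForm F.isOpen S.contMDiff_η F.contMDiffOn_ξ
    (fun x _ ↦ S.η_ξ x) hf hX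

/-- The connection form `v ↦ δ g(∇_v e, φ e)` of the frame. -/
def connForm (x : M) (v : TangentSpace I x) : ℝ := F.δ * g.val x (g.leviCivita F.e x v) (F.e' x)

lemma contMDiffOn_connForm {X : ∀ x : M, TangentSpace I x} (hX : CMDiff[U] ∞ (T% X)) :
    CMDiff[U] ∞ (fun x ↦ F.connForm x (X x)) := by
  have he := F.contMDiffOn_e
  have he' := F.contMDiffOn_e'
  have br {Y Z : ∀ x : M, TangentSpace I x} (hY : CMDiff[U] ∞ (T% Y)) (hZ : CMDiff[U] ∞ (T% Z)) :=
    ContMDiffOn.mlieBracket_of_isOpen F.isOpen hY hZ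
  have hk : CMDiff[U] ∞ (fun x ↦ F.δ * (1 / 2 * g.koszul F.e X F.e' x)) := by
    refine contMDiffOn_const.mul (contMDiffOn_const.mul ?_)
    exact (((((F.contMDiffOn_mvfderiv hX (g.contMDiffOn_val he he')).add
      (F.contMDiffOn_mvfderiv he (g.contMDiffOn_val he' hX))).sub
      (F.contMDiffOn_mvfderiv he' (g.contMDiffOn_val hX he))).add
      (g.contMDiffOn_val (br hX he) he')).sub (g.contMDiffOn_val (br he he') hX)).add
      (g.contMDiffOn_val (br he' hX) he)
  refine hk.congr fun x hx ↦ ?_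
  rw [connForm, g.val_leviCivita (F.isOpen.mdifferentiableAt_section hX hx)
    (F.isOpen.mdifferentiableAt_section he hx) (F.isOpen.mdifferentiableAt_section he' hx)]

variable [Fact (Module.finrank ℝ E = 3)]

lemma nabla_e (hS : S.IsKenmotsu) {x : M} (hx : x ∈ U) (v : TangentSpace I x) :
    g.leviCivita F.e x v = F.connForm x v • F.e' x - (ε * g.val x v (F.e x)) • S.ξ x := by
  have he := F.isOpen.mdifferentiableAt_section F.contMDiffOn_e hx
  have h1 := g.mvfderiv_val he he v
  have h2 := g.mvfderiv_val he (S.mdifferentiableAt_ξ x) v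
  rw [smoothFunctions.mvfderiv_congr F.isOpen (G := fun _ ↦ F.δ) (fun y hy ↦ F.val_e y hy) hx,
    mvfderiv_const, g.symm x (F.e x), zero_apply] at h1
  rw [smoothFunctions.mvfderiv_congr F.isOpen (G := fun _ ↦ 0)
    (fun y hy ↦ by rw [S.val_ξ, F.η_e y hy, mul_zero]) hx, mvfderiv_const, S.val_ξ, hS.nabla_ξ,
    map_sub, map_smul, S.val_ξ, F.η_e x hx, zero_apply, g.symm x (F.e x)] at h2
  rw [← F.comb_coord hx (g.leviCivita F.e x v)]
  have h3 : g.val x (g.leviCivita F.e x v) (F.e x) = 0 := by linarith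
  have h4 : S.η x (g.leviCivita F.e x v) = -(ε * g.val x v (F.e x)) := by
    simp only [mul_zero, smul_zero, sub_zero] at h2
    linear_combination -ε * h2 - S.η x (g.leviCivita F.e x v) * S.ε_mul_self
  simp only [comb, coord, h3, h4, Matrix.cons_val, connForm]
  module

lemma nabla_e' (hS : S.IsKenmotsu) {x : M} (hx : x ∈ U) (v : TangentSpace I x) :
    g.leviCivita F.e' x v = -(F.connForm x v • F.e x) - (ε * g.val x v (F.e' x)) • S.ξ x := by
  have he := F.isOpen.mdifferentiableAt_section F.contMDiffOn_e hx
  have h := hS.nabla_φ he v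
  rw [F.nabla_e hS hx, F.η_e x hx, map_sub, map_smul, map_smul, S.φ_ξ, F.φ_e' hx] at h
  refine h.trans ?_
  rw [F.φ_e]
  module

end AdaptedFrame

end AdaptedFrames

/-! ### Components in an adapted frame -/

section Components

open smoothFunctions

variable {E : Type*} [NormedAddCommGroup E] [NormedSpace ℝ E]
  {H : Type*} [TopologicalSpace H] {I : ModelWithCorners ℝ E H}
  {M : Type*} [TopologicalSpace M] [ChartedSpace H M] [IsManifold I ∞ M]
  {g : PseudoRiemannianMetric I M} {ε : ℝ}
  {S : AlmostContactPseudoMetricStructure g ε} {U : Set M}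

namespace AdaptedFrame

variable (F : AdaptedFrame S U) {X Y Z : ∀ x : M, TangentSpace I x}
  {c d : Fin 3 → smoothFunctions I U}

/-- The vector field `X` has the smooth components `c` in the frame over `U`. -/
def HasComponents (X : ∀ x : M, TangentSpace I x) (c : Fin 3 → smoothFunctions I U) : Prop :=
  ∀ x (hx : x ∈ U), X x = F.comb x (fun k ↦ (c k).1 ⟨x, hx⟩)

variable {F}

lemma HasComponents.unique (hc : F.HasComponents X c) (hd : F.HasComponents X d) : c = d := by
  funext k
  ext ⟨x, hx⟩
  have h := congrArg (F.coord x) ((hc x hx).symm.trans (hd x hx))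
  rw [F.coord_comb hx, F.coord_comb hx] at h
  exact congrFun h k

lemma HasComponents.contMDiffOn (hc : F.HasComponents X c) : CMDiff[U] ∞ (T% X) := by
  have h : CMDiff[U] ∞ (T% (lift (c 0) • F.e + lift (c 1) • F.e' + lift (c 2) • S.ξ :
      ∀ x : M, TangentSpace I x)) :=
    (((contMDiffOn_lift _).smul_section F.contMDiffOn_e).add_section
      ((contMDiffOn_lift _).smul_section F.contMDiffOn_e')).add_section
      ((contMDiffOn_lift _).smul_section F.contMDiffOn_ξ)
  refine h.congr fun x hx ↦ ?_
  simp [hc x hx, comb, lift_of_mem _ hx]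

lemma HasComponents.sub (hc : F.HasComponents X c) (hd : F.HasComponents Y d) :
    F.HasComponents (X - Y) (c - d) := fun x hx ↦ by
  rw [Pi.sub_apply, hc x hx, hd x hx, ← F.comb_sub]
  rfl

lemma HasComponents.val (hc : F.HasComponents X c) (hd : F.HasComponents Y d) {x : M}
    (hx : x ∈ U) : g.val x (X x) (Y x) =
      F.δ * ((c 0).1 ⟨x, hx⟩ * (d 0).1 ⟨x, hx⟩ + (c 1).1 ⟨x, hx⟩ * (d 1).1 ⟨x, hx⟩)
        + ε * ((c 2).1 ⟨x, hx⟩ * (d 2).1 ⟨x, hx⟩) := by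
  rw [hc x hx, hd x hx, F.val_comb hx]

variable (F)

lemma hasComponents_e : F.HasComponents F.e ![1, 0, 0] := fun x _ ↦ by simp [comb]

lemma hasComponents_e' : F.HasComponents F.e' ![0, 1, 0] := fun x _ ↦ by simp [comb]

lemma hasComponents_ξ : F.HasComponents S.ξ ![0, 0, 1] := fun x _ ↦ by simp [comb]

variable [FiniteDimensional ℝ E]

/-- The derivation along the first field of the frame. -/
def D₁ : Derivation ℝ (smoothFunctions I U) (smoothFunctions I U) :=
  derivation F.isOpen F.e fun _ hf ↦ F.contMDiffOn_mvfderiv F.contMDiffOn_e hf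

/-- The derivation along the second field of the frame. -/
def D₂ : Derivation ℝ (smoothFunctions I U) (smoothFunctions I U) :=
  derivation F.isOpen F.e' fun _ hf ↦ F.contMDiffOn_mvfderiv F.contMDiffOn_e' hf

/-- The derivation along the Reeb field. -/
def D₃ : Derivation ℝ (smoothFunctions I U) (smoothFunctions I U) :=
  derivation F.isOpen S.ξ fun _ hf ↦ F.contMDiffOn_mvfderiv F.contMDiffOn_ξ hf

/-- The value of the connection form on the first field of the frame. -/
def p : smoothFunctions I U :=
  smoothFunctions.restrict (fun x ↦ F.connForm x (F.e x)) (F.contMDiffOn_connForm F.contMDiffOn_e)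

/-- The value of the connection form on the second field of the frame. -/
def q : smoothFunctions I U :=
  smoothFunctions.restrict (fun x ↦ F.connForm x (F.e' x)) (F.contMDiffOn_connForm F.contMDiffOn_e')

/-- The value of the connection form on the Reeb field. -/
def s : smoothFunctions I U :=
  smoothFunctions.restrict (fun x ↦ F.connForm x (S.ξ x)) (F.contMDiffOn_connForm F.contMDiffOn_ξ)

/-- The constant function `ε δ`. -/
def σ : smoothFunctions I U := algebraMap ℝ _ (ε * F.δ)

/-- The function whose vanishing expresses that the curvature is constant equal to `-ε`. -/
def curv : smoothFunctions I U := F.D₂ F.p - F.D₁ F.q - F.p * F.p - F.q * F.q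

/-- The components of `∇_X Z` in terms of those of `X` and `Z`. -/
abbrev nabla (c d : Fin 3 → smoothFunctions I U) : Fin 3 → smoothFunctions I U :=
  frameNabla F.D₁ F.D₂ F.D₃ F.p F.q F.s F.σ c d

variable {F}

lemma HasComponents.mvfderiv (hc : F.HasComponents X c) (f : smoothFunctions I U) {x : M}
    (hx : x ∈ U) : mvfderiv I (lift f) x (X x) =
      (c 0 * F.D₁ f + c 1 * F.D₂ f + c 2 * F.D₃ f).1 ⟨x, hx⟩ := by
  rw [hc x hx, comb, map_add, map_add, map_smul, map_smul, map_smul]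
  rfl

lemma HasComponents.connForm (hc : F.HasComponents X c) {x : M} (hx : x ∈ U) :
    F.connForm x (X x) = (c 0 * F.p + c 1 * F.q + c 2 * F.s).1 ⟨x, hx⟩ := by
  rw [hc x hx, comb, AdaptedFrame.connForm]
  simp only [p, q, s, AdaptedFrame.connForm, map_add, map_smul, add_apply, smul_apply, smul_eq_mul,
    Subalgebra.coe_add, Subalgebra.coe_mul, Pi.add_apply, Pi.mul_apply,
    smoothFunctions.restrict_apply]
  ring

variable (F) in
/-- The commutator of the derivations along two fields is the derivation along their bracket. -/
lemma commutator_apply (hX : CMDiff[U] ∞ (T% X)) (hY : CMDiff[U] ∞ (T% Y))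
    (hb : F.HasComponents (VectorField.mlieBracket I X Y) c) (f : smoothFunctions I U) :
    let DX := derivation F.isOpen X fun _ hf ↦ F.contMDiffOn_mvfderiv hX hf
    let DY := derivation F.isOpen Y fun _ hf ↦ F.contMDiffOn_mvfderiv hY hf
    DX (DY f) - DY (DX f) = c 0 * F.D₁ f + c 1 * F.D₂ f + c 2 * F.D₃ f := by
  intro DX DY
  ext ⟨x, hx⟩
  have h := mvfderiv_mlieBracket F.isOpen (contMDiffOn_lift f) hX hY F.contMDiffOn_ξ
    (F.contMDiffOn_mvfderiv hX (contMDiffOn_lift f)) (F.contMDiffOn_mvfderiv hY (contMDiffOn_lift f))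
    hx (fun h0 ↦ by simpa [h0] using S.η_ξ x)
  rw [hb.mvfderiv f hx] at h
  rw [h,
    ← mvfderiv_lift F.isOpen (DY f) (F := fun y ↦ mvfderiv I (lift f) y (Y y)) (fun y hy ↦ rfl) hx,
    ← mvfderiv_lift F.isOpen (DX f) (F := fun y ↦ mvfderiv I (lift f) y (X y)) (fun y hy ↦ rfl) hx]
  rfl

variable [Fact (Module.finrank ℝ E = 3)]

lemma exists_hasComponents (hX : CMDiff[U] ∞ (T% X)) : ∃ c, F.HasComponents X c :=
  ⟨fun k ↦ smoothFunctions.restrict (fun x ↦ F.coord x (X x) k) (F.contMDiffOn_coord hX k),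
    fun _ hx ↦ (F.comb_coord hx _).symm⟩

/-- The components of a covariant derivative. -/
lemma HasComponents.nabla (hS : S.IsKenmotsu) (hc : F.HasComponents X c)
    (hd : F.HasComponents Z d) :
    F.HasComponents (fun y ↦ g.leviCivita Z y (X y)) (F.nabla c d) := by
  intro x hx
  have hcov := g.leviCivita.isCovariantDerivativeOnUniv
  have me := F.isOpen.mdifferentiableAt_section F.contMDiffOn_e hx
  have me' := F.isOpen.mdifferentiableAt_section F.contMDiffOn_e' hx
  have mξ := F.isOpen.mdifferentiableAt_section F.contMDiffOn_ξ hx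
  have ml (k : Fin 3) := F.isOpen.mdifferentiableAt_function (contMDiffOn_lift (d k)) hx
  have sm {f : M → ℝ} {W : ∀ x : M, TangentSpace I x} (hf : MDiffAt f x) (hW : MDiffAt (T% W) x) :
    MDiffAt (T% (f • W)) x := hf.smul_section hW
  have hZ : g.leviCivita Z x = g.leviCivita
      (lift (d 0) • F.e + lift (d 1) • F.e' + lift (d 2) • S.ξ) x := by
    refine (g.leviCivita.isCovariantDerivativeOn (s := U)).congr_of_eqOn
      (F.isOpen.mdifferentiableAt_section hd.contMDiffOn hx)
      (mdifferentiableAt_add_section (mdifferentiableAt_add_section (sm (ml 0) me) (sm (ml 1) me'))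
        (sm (ml 2) mξ)) (F.isOpen.mem_nhds hx) fun y hy ↦ ?_
    simp [hd y hy, comb, lift_of_mem _ hy]
  change g.leviCivita Z x (X x) = _
  rw [hZ, hcov.add (mdifferentiableAt_add_section (sm (ml 0) me) (sm (ml 1) me')) (sm (ml 2) mξ),
    hcov.add (sm (ml 0) me) (sm (ml 1) me'), hcov.leibniz me (ml 0), hcov.leibniz me' (ml 1),
    hcov.leibniz mξ (ml 2)]
  have hδ := F.δ_mul_self
  have v1 := hc.val F.hasComponents_e hx
  have v2 := hc.val F.hasComponents_e' hx
  have v3 : S.η x (X x) = (c 2).1 ⟨x, hx⟩ := by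
    have := congrFun (F.coord_comb hx fun k ↦ (c k).1 ⟨x, hx⟩) 2
    rwa [← hc x hx] at this
  have hXx := hc x hx
  simp only [add_apply, smul_apply, ContinuousLinearMap.smulRight_apply]
  change _ • g.leviCivita F.e x (X x) + _ + (_ • g.leviCivita F.e' x (X x) + _)
    + (_ • g.leviCivita S.ξ x (X x) + _) = _
  rw [F.nabla_e hS hx, F.nabla_e' hS hx, hS.nabla_ξ, hc.mvfderiv _ hx, hc.mvfderiv _ hx,
    hc.mvfderiv _ hx, hc.connForm hx, v1, v2, v3, hXx]
  simp only [lift_of_mem _ hx, comb, AdaptedFrame.nabla, frameNabla, Matrix.cons_val, σ,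
    Subalgebra.coe_add, Subalgebra.coe_sub, Subalgebra.coe_mul, Pi.add_apply, Pi.sub_apply,
    Pi.mul_apply, Subalgebra.coe_algebraMap, Pi.algebraMap_apply, Algebra.algebraMap_self_apply,
    Subalgebra.coe_one, Subalgebra.coe_zero, Pi.one_apply, Pi.zero_apply]
  module

lemma HasComponents.mlieBracket (hS : S.IsKenmotsu) (hc : F.HasComponents X c)
    (hd : F.HasComponents Y d) :
    F.HasComponents (mlieBracket I X Y) (F.nabla c d - F.nabla d c) := by
  intro x hx
  have h := (hc.nabla hS hd).sub (hd.nabla hS hc) x hx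
  rw [← h]
  exact (g.leviCivita.torsion_eq_zero_iff.1 g.leviCivita_torsion
    (F.isOpen.mdifferentiableAt_section hc.contMDiffOn hx)
    (F.isOpen.mdifferentiableAt_section hd.contMDiffOn hx)).symm

lemma HasComponents.curvatureField (hS : S.IsKenmotsu) {b : Fin 3 → smoothFunctions I U}
    (hb : F.HasComponents X b) (hc : F.HasComponents Y c) (hd : F.HasComponents Z d) :
    F.HasComponents (g.curvatureField X Y Z) (F.nabla b (F.nabla c d) - F.nabla c (F.nabla b d)
      - F.nabla (F.nabla b c - F.nabla c b) d) :=
  ((hb.nabla hS (hc.nabla hS hd)).sub (hc.nabla hS (hb.nabla hS hd))).sub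
    ((hb.mlieBracket hS hc).nabla hS hd)

variable (F)

lemma hasComponents_mlieBracket_e_e' (hS : S.IsKenmotsu) :
    F.HasComponents (VectorField.mlieBracket I F.e F.e') ![-F.p, -F.q, 0] := by
  convert F.hasComponents_e.mlieBracket hS F.hasComponents_e' using 1
  funext k
  fin_cases k <;> simp [frameNabla]

lemma hasComponents_mlieBracket_e_ξ (hS : S.IsKenmotsu) :
    F.HasComponents (VectorField.mlieBracket I F.e S.ξ) ![1, -F.s, 0] := by
  convert F.hasComponents_e.mlieBracket hS F.hasComponents_ξ using 1
  funext k
  fin_cases k <;> simp [frameNabla]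

lemma hasComponents_mlieBracket_e'_ξ (hS : S.IsKenmotsu) :
    F.HasComponents (VectorField.mlieBracket I F.e' S.ξ) ![F.s, 1, 0] := by
  convert F.hasComponents_e'.mlieBracket hS F.hasComponents_ξ using 1
  funext k
  fin_cases k <;> simp [frameNabla]

/-- The structure equations hold for an adapted frame of a Kenmotsu manifold. The equations for
`D₃ p` and `D₃ q` are the Jacobi identity of the three fields of the frame. -/
theorem frameEquations (hS : S.IsKenmotsu) :
    FrameEquations F.D₁ F.D₂ F.D₃ F.p F.q F.s F.σ (algebraMap ℝ _ F.δ) F.curv := by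
  have j1 := F.hasComponents_e.mlieBracket hS (F.hasComponents_mlieBracket_e'_ξ hS)
  have j2 := (F.hasComponents_mlieBracket_e_e' hS).mlieBracket hS F.hasComponents_ξ
  have j3 := F.hasComponents_e'.mlieBracket hS (F.hasComponents_mlieBracket_e_ξ hS)
  have hJ : F.HasComponents (VectorField.mlieBracket I F.e (VectorField.mlieBracket I F.e' S.ξ)
      - VectorField.mlieBracket I (VectorField.mlieBracket I F.e F.e') S.ξ
      - VectorField.mlieBracket I F.e' (VectorField.mlieBracket I F.e S.ξ)) 0 := by
    intro x hx
    have : IsManifold I (minSmoothness ℝ 3) M := by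
      simp only [minSmoothness_of_isRCLikeNormedField]
      exact IsManifold.of_le (n := ∞) (WithTop.coe_le_coe.2 le_top)
    have cd {W : ∀ x : M, TangentSpace I x} (hW : CMDiff[U] ∞ (T% W)) :
        CMDiffAt (minSmoothness ℝ 2) (T% W) x :=
      (hW.contMDiffAt (F.isOpen.mem_nhds hx)).of_le (by
        simp only [minSmoothness_of_isRCLikeNormedField]; exact WithTop.coe_le_coe.2 le_top)
    have h := leibniz_identity_mlieBracket_apply (cd F.contMDiffOn_e) (cd F.contMDiffOn_e')
      (cd F.contMDiffOn_ξ)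
    simp only [Pi.sub_apply, h, comb]
    simp
  have key := ((j1.sub j2).sub j3).unique hJ
  have k0 := congrFun key 0
  have k1 := congrFun key 1
  simp only [AdaptedFrame.nabla, frameNabla, Pi.sub_apply, Matrix.cons_val, map_zero, map_neg,
    Pi.zero_apply, Derivation.map_one_eq_zero] at k0 k1
  constructor
  · rw [σ, ← map_mul, show ε * F.δ * (ε * F.δ) = 1 by
      linear_combination S.ε_mul_self * F.δ * F.δ + F.δ_mul_self, map_one]
  · rw [← map_mul, F.δ_mul_self, map_one]
  · exact F.D₁.map_algebraMap _
  · exact F.D₂.map_algebraMap _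
  · exact F.D₃.map_algebraMap _
  · exact F.D₁.map_algebraMap _
  · exact F.D₂.map_algebraMap _
  · exact F.D₃.map_algebraMap _
  · intro f
    refine (F.commutator_apply F.contMDiffOn_e F.contMDiffOn_e'
      (F.hasComponents_mlieBracket_e_e' hS) f).trans ?_
    simp only [Matrix.cons_val]
    ring
  · intro f
    refine (F.commutator_apply F.contMDiffOn_e F.contMDiffOn_ξ
      (F.hasComponents_mlieBracket_e_ξ hS) f).trans ?_
    simp only [Matrix.cons_val]
    ring
  · intro f
    refine (F.commutator_apply F.contMDiffOn_e' F.contMDiffOn_ξ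
      (F.hasComponents_mlieBracket_e'_ξ hS) f).trans ?_
    simp only [Matrix.cons_val]
    ring
  · rfl
  · linear_combination -k0
  · linear_combination -k1

end AdaptedFrame

end Components

/-! ### Curvature and Ricci solitons in an adapted frame -/

section CurvatureAndSolitons

open smoothFunctions

variable {E : Type*} [NormedAddCommGroup E] [NormedSpace ℝ E] [FiniteDimensional ℝ E]
  {H : Type*} [TopologicalSpace H] {I : ModelWithCorners ℝ E H}
  {M : Type*} [TopologicalSpace M] [ChartedSpace H M] [IsManifold I ∞ M]
  {g : PseudoRiemannianMetric I M} {ε : ℝ}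
  {S : AlmostContactPseudoMetricStructure g ε} {U : Set M}

/-- Since `∇` is torsion-free and metric, `L_V g` is twice the symmetric part of `∇ V`. -/
lemma PseudoRiemannianMetric.lieDerivative_eq (g : PseudoRiemannianMetric I M)
    {V X Y : ∀ x : M, TangentSpace I x} {x : M} (hV : MDiffAt (T% V) x) (hX : MDiffAt (T% X) x)
    (hY : MDiffAt (T% Y) x) : g.lieDerivative V X Y x =
      g.val x (g.leviCivita V x (X x)) (Y x) + g.val x (X x) (g.leviCivita V x (Y x)) := by
  have ht {Z : ∀ x : M, TangentSpace I x} (hZ : MDiffAt (T% Z) x) :=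
    g.leviCivita.torsion_eq_zero_iff.1 g.leviCivita_torsion hV hZ
  rw [lieDerivative, ← ht hX, ← ht hY, g.mvfderiv_val hX hY, map_sub, map_sub, sub_apply]
  ring

namespace AdaptedFrame

variable (F : AdaptedFrame S U)

lemma curv_apply {x : M} (hx : x ∈ U) : F.curv.1 ⟨x, hx⟩ =
    mvfderiv I (fun y ↦ F.connForm y (F.e y)) x (F.e' x)
      - mvfderiv I (fun y ↦ F.connForm y (F.e' y)) x (F.e x)
      - F.connForm x (F.e x) * F.connForm x (F.e x)
      - F.connForm x (F.e' x) * F.connForm x (F.e' x) := by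
  rw [← mvfderiv_lift F.isOpen F.p (F := fun y ↦ F.connForm y (F.e y)) (fun y hy ↦ rfl) hx,
    ← mvfderiv_lift F.isOpen F.q (F := fun y ↦ F.connForm y (F.e' y)) (fun y hy ↦ rfl) hx]
  rfl

lemma curv_restrict {U' : Set M} (hU' : IsOpen U') (h : U' ⊆ U) {x : M} (hx : x ∈ U') :
    (F.restrict hU' h).curv.1 ⟨x, hx⟩ = F.curv.1 ⟨x, h hx⟩ := by
  rw [curv_apply, curv_apply]
  rfl

variable [Fact (Module.finrank ℝ E = 3)]

lemma curvatureField_apply (hS : S.IsKenmotsu) {X Y Z : ∀ x : M, TangentSpace I x}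
    (hX : CMDiff[U] ∞ (T% X)) (hY : CMDiff[U] ∞ (T% Y)) (hZ : CMDiff[U] ∞ (T% Z)) {x : M}
    (hx : x ∈ U) : g.curvatureField X Y Z x =
      -ε • (g.val x (Y x) (Z x) • X x - g.val x (X x) (Z x) • Y x)
        + (F.curv.1 ⟨x, hx⟩ * (F.coord x (X x) 0 * F.coord x (Y x) 1
            - F.coord x (X x) 1 * F.coord x (Y x) 0)) •
          F.comb x ![F.coord x (Z x) 1, -F.coord x (Z x) 0, 0] := by
  obtain ⟨b, hb⟩ := F.exists_hasComponents hX
  obtain ⟨c, hc⟩ := F.exists_hasComponents hY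
  obtain ⟨d, hd⟩ := F.exists_hasComponents hZ
  have hR := hb.curvatureField hS hc hd x hx
  rw [(F.frameEquations hS).frameNabla_curvature b c d] at hR
  rw [hR, hc.val hd hx, hb.val hd hx, hb x hx, hc x hx, hd x hx]
  simp only [F.coord_comb hx]
  rw [← F.comb_smul, ← F.comb_smul, ← F.comb_sub, ← F.comb_smul, ← F.comb_smul, ← F.comb_add]
  congr 1
  have hε := S.ε_mul_self
  generalize F.curv = f
  funext k
  fin_cases k <;>
  simp only [σ, Pi.add_apply, Pi.sub_apply, Pi.smul_apply, smul_eq_mul, Matrix.cons_val,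
    Subalgebra.coe_add, Subalgebra.coe_sub, Subalgebra.coe_mul, Pi.mul_apply, Subalgebra.coe_neg,
    Pi.neg_apply, Subalgebra.coe_algebraMap, Pi.algebraMap_apply, Algebra.algebraMap_self_apply,
    Fin.zero_eta, Fin.mk_one, Fin.reduceFinMk, Subalgebra.coe_zero, Pi.zero_apply]
  · linear_combination (((c 2).1 ⟨x, hx⟩ * (b 0).1 ⟨x, hx⟩ - (b 2).1 ⟨x, hx⟩ * (c 0).1 ⟨x, hx⟩)
      * (d 2).1 ⟨x, hx⟩) * hε
  · linear_combination (((c 2).1 ⟨x, hx⟩ * (b 1).1 ⟨x, hx⟩ - (b 2).1 ⟨x, hx⟩ * (c 1).1 ⟨x, hx⟩)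
      * (d 2).1 ⟨x, hx⟩) * hε
  · ring

/-- The curvature tensor at a point. The given tangent vectors extend to fields which are smooth
near the point, so the frame has to be restricted before their components can be used. -/
theorem curvature_eq (hS : S.IsKenmotsu) {x : M} (hx : x ∈ U) (u v w : TangentSpace I x) :
    g.curvature x u v w = -ε • (g.val x v w • u - g.val x u w • v)
      + (F.curv.1 ⟨x, hx⟩ * (F.coord x u 0 * F.coord x v 1 - F.coord x u 1 * F.coord x v 0)) •
        F.comb x ![F.coord x w 1, -F.coord x w 0, 0] := by
  obtain ⟨s₁, hs₁, hu⟩ := exists_contMDiffOn_extend (k := ∞) I E u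
  obtain ⟨s₂, hs₂, hv⟩ := exists_contMDiffOn_extend (k := ∞) I E v
  obtain ⟨s₃, hs₃, hw⟩ := exists_contMDiffOn_extend (k := ∞) I E w
  obtain ⟨U', hU's, hU', hxU'⟩ := mem_nhds_iff.1 (Filter.inter_mem (Filter.inter_mem hs₁ hs₂)
    (Filter.inter_mem hs₃ (F.isOpen.mem_nhds hx)))
  have hU'U : U' ⊆ U := fun y hy ↦ (hU's hy).2.2
  have h := (F.restrict hU' hU'U).curvatureField_apply hS (hu.mono fun y hy ↦ (hU's hy).1.1)
    (hv.mono fun y hy ↦ (hU's hy).1.2) (hw.mono fun y hy ↦ (hU's hy).2.1) hxU'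
  simp only [extend_apply_self, F.curv_restrict hU' hU'U hxU'] at h
  exact h

/-- The Ricci tensor at a point. -/
theorem ricci_eq (hS : S.IsKenmotsu) {x : M} (hx : x ∈ U) (v w : TangentSpace I x) :
    g.ricci x v w = -(2 * ε) * g.val x v w
      + F.curv.1 ⟨x, hx⟩ * (F.coord x v 0 * F.coord x w 0 + F.coord x v 1 * F.coord x w 1) := by
  let α : TangentSpace I x →ₗ[ℝ] ℝ :=
    (F.δ * F.coord x v 1) • (g.val x (F.e x) : TangentSpace I x →ₗ[ℝ] ℝ)
      - (F.δ * F.coord x v 0) • (g.val x (F.e' x) : TangentSpace I x →ₗ[ℝ] ℝ)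
  let z : TangentSpace I x := F.comb x ![F.coord x w 1, -F.coord x w 0, 0]
  let L : TangentSpace I x →ₗ[ℝ] TangentSpace I x :=
    -ε • (g.val x v w • LinearMap.id - (g.val x w : TangentSpace I x →ₗ[ℝ] ℝ).smulRight v)
      + F.curv.1 ⟨x, hx⟩ • α.smulRight z
  have hL (u : TangentSpace I x) : L u = g.curvature x u v w := by
    rw [F.curvature_eq hS hx]
    simp only [L, α, z, coord, Matrix.cons_val, LinearMap.add_apply, LinearMap.smul_apply,
      LinearMap.sub_apply, LinearMap.smulRight_apply, LinearMap.id_apply, smul_eq_mul,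
      ContinuousLinearMap.coe_coe, g.symm x w u, g.symm x (F.e x) u, g.symm x (F.e' x) u]
    module
  have htr : LinearMap.trace ℝ (TangentSpace I x) L = g.ricci x v w := by
    rw [LinearMap.trace_eq_matrix_trace ℝ (Module.finBasis ℝ (TangentSpace I x))]
    simp only [Matrix.trace, Matrix.diag, LinearMap.toMatrix_apply, hL]
    rfl
  have hdim : Module.finrank ℝ (TangentSpace I x) = 3 := Fact.out (p := Module.finrank ℝ E = 3)
  have hz : F.coord x z = ![F.coord x w 1, -F.coord x w 0, 0] := F.coord_comb hx _
  have hz0 : F.δ * g.val x (F.e x) z = F.coord x w 1 := by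
    rw [g.symm]
    exact congrFun hz 0
  have hz1 : F.δ * g.val x (F.e' x) z = -F.coord x w 0 := by
    rw [g.symm]
    exact congrFun hz 1
  rw [← htr]
  simp only [L, α, map_add, map_smul, map_sub, LinearMap.trace_id, LinearMap.trace_smulRight, hdim,
    LinearMap.smul_apply, LinearMap.sub_apply, smul_eq_mul, ContinuousLinearMap.coe_coe,
    g.symm x w v]
  push_cast
  linear_combination F.curv.1 ⟨x, hx⟩ * (F.coord x v 1 * hz0 - F.coord x v 0 * hz1)

variable {F} in
/-- The soliton equation in components. -/
lemma HasComponents.soliton_eq (hS : S.IsKenmotsu) {V X Y : ∀ x : M, TangentSpace I x} {l : ℝ}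
    (hV : g.IsRicciSoliton V l) {b c d : Fin 3 → smoothFunctions I U} (hc : F.HasComponents V c)
    (hb : F.HasComponents X b) (hd : F.HasComponents Y d) :
    algebraMap ℝ _ F.δ * (F.nabla b c 0 * d 0 + F.nabla b c 1 * d 1
        + (b 0 * F.nabla d c 0 + b 1 * F.nabla d c 1)
        + (2 * algebraMap ℝ _ (l - 2 * ε)) * (b 0 * d 0 + b 1 * d 1))
      + algebraMap ℝ _ ε * (F.nabla b c 2 * d 2 + b 2 * F.nabla d c 2
        + (2 * algebraMap ℝ _ (l - 2 * ε)) * (b 2 * d 2))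
      + 2 * F.curv * (b 0 * d 0 + b 1 * d 1) = 0 := by
  ext ⟨x, hx⟩
  have mV := F.isOpen.mdifferentiableAt_section hc.contMDiffOn hx
  have mX := F.isOpen.mdifferentiableAt_section hb.contMDiffOn hx
  have mY := F.isOpen.mdifferentiableAt_section hd.contMDiffOn hx
  have h := hV.eq X Y x mX mY
  have h1 := (hb.nabla hS hc).val hd hx
  have h2 := hb.val (hd.nabla hS hc) hx
  have two_val : (2 : smoothFunctions I U).1 ⟨x, hx⟩ = 2 := rfl
  rw [g.lieDerivative_eq mV mX mY, F.ricci_eq hS hx, h1, h2, hb.val hd hx, hb x hx, hd x hx,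
    F.coord_comb hx, F.coord_comb hx] at h
  simp only [Subalgebra.coe_add, Subalgebra.coe_sub, Subalgebra.coe_mul, Pi.add_apply, Pi.sub_apply,
    Pi.mul_apply, Subalgebra.coe_algebraMap, Pi.algebraMap_apply, Algebra.algebraMap_self_apply,
    Subalgebra.coe_zero, Pi.zero_apply, map_sub, map_mul, two_val]
  generalize F.curv = f at *
  generalize F.nabla b c = y at *
  generalize F.nabla d c = z at *
  linear_combination h

/-- A Kenmotsu three-manifold with a Ricci soliton has no curvature excess. -/
theorem curv_eq_zero (hS : S.IsKenmotsu) {V : ∀ x : M, TangentSpace I x} {l : ℝ}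
    (hV : g.IsRicciSoliton V l) : F.curv = 0 := by
  obtain ⟨c, hc⟩ := F.exists_hasComponents hV.contMDiff.contMDiffOn
  have h11 := hc.soliton_eq hS hV F.hasComponents_e F.hasComponents_e
  have h22 := hc.soliton_eq hS hV F.hasComponents_e' F.hasComponents_e'
  have h12 := hc.soliton_eq hS hV F.hasComponents_e F.hasComponents_e'
  have h13 := hc.soliton_eq hS hV F.hasComponents_e F.hasComponents_ξ
  have h23 := hc.soliton_eq hS hV F.hasComponents_e' F.hasComponents_ξ
  have h33 := hc.soliton_eq hS hV F.hasComponents_ξ F.hasComponents_ξ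
  have hF := F.frameEquations hS
  have hδ := hF.sq_δ
  have hε : algebraMap ℝ (smoothFunctions I U) ε * algebraMap ℝ _ ε = 1 := by
    rw [← map_mul, S.ε_mul_self, map_one]
  have hσ : F.σ = algebraMap ℝ _ ε * algebraMap ℝ _ F.δ := map_mul _ _ _
  have hσσ := hF.sq_σ
  have hl : algebraMap ℝ (smoothFunctions I U) (l - 2 * ε) = -algebraMap ℝ _ (2 * ε - l) := by
    rw [← map_neg, neg_sub]
  rw [hl] at h11 h22 h12 h13 h23 h33
  simp only [AdaptedFrame.nabla, frameNabla, Matrix.cons_val, mul_zero, mul_one, zero_mul, one_mul,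
    add_zero, zero_add, sub_zero] at h11 h22 h12 h13 h23 h33
  generalize F.curv = f at *
  refine hF.curv_eq_zero_of_soliton (u := c 0) (v := c 1) (a := c 2)
    (m := algebraMap ℝ _ (2 * ε - l)) (F.D₁.map_algebraMap _) (F.D₂.map_algebraMap _)
    (F.D₃.map_algebraMap _) ?_ ?_ ?_ ?_ ?_ ?_
  all_goals
    generalize algebraMap ℝ (smoothFunctions I U) (2 * ε - l) = m at *
    generalize algebraMap ℝ (smoothFunctions I U) ε = e at *
    generalize algebraMap ℝ (smoothFunctions I U) F.δ = r at *
  · refine sub_eq_zero.1 (eq_zero_of_ofNat_mul_eq_zero (n := 2) ?_)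
    linear_combination r * h11 - 2 * (F.D₁ (c 0) - c 1 * F.p + c 2 - m) * hδ
  · refine sub_eq_zero.1 (eq_zero_of_ofNat_mul_eq_zero (n := 2) ?_)
    linear_combination r * h22 - 2 * (F.D₂ (c 1) + c 0 * F.q + c 2 - m) * hδ
  · linear_combination r * h12
      - (F.D₁ (c 1) + c 0 * F.p + (F.D₂ (c 0) - c 1 * F.q)) * hδ
  · linear_combination r * h13 - (F.D₃ (c 0) - c 1 * F.s) * hδ + F.D₁ (c 2) * hσ
      + c 0 * hσσ - c 0 * F.σ * hσ
  · linear_combination r * h23 - (F.D₃ (c 1) + c 0 * F.s) * hδ + F.D₂ (c 2) * hσ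
      + c 1 * hσσ - c 1 * F.σ * hσ
  · refine sub_eq_zero.1 (eq_zero_of_ofNat_mul_eq_zero (n := 2) ?_)
    linear_combination e * h33 - 2 * (F.D₃ (c 2) - m) * hε

end AdaptedFrame

end CurvatureAndSolitons

/-! ### Existence of adapted frames -/

section Existence

variable {E : Type*} [NormedAddCommGroup E] [NormedSpace ℝ E] [FiniteDimensional ℝ E]
  {H : Type*} [TopologicalSpace H] {I : ModelWithCorners ℝ E H}
  {M : Type*} [TopologicalSpace M] [ChartedSpace H M] [IsManifold I ∞ M]
  {g : PseudoRiemannianMetric I M} {ε : ℝ}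
  (S : AlmostContactPseudoMetricStructure g ε)

/-- The metric is nondegenerate on `ker η = ξ^⊥`, so it does not vanish identically there. -/
lemma AlmostContactPseudoMetricStructure.exists_val_self_ne_zero
    (hE : 1 < Module.finrank ℝ E) (x : M) :
    ∃ u : TangentSpace I x, S.η x u = 0 ∧ g.val x u u ≠ 0 := by
  by_contra! h
  have hker : LinearMap.ker (S.η x : TangentSpace I x →ₗ[ℝ] ℝ) ≠ ⊥ := by
    refine LinearMap.ker_ne_bot_of_finrank_lt ?_
    rw [Module.finrank_self]
    exact hE
  obtain ⟨u, hu, hu0⟩ := Submodule.exists_mem_ne_zero_of_ne_bot hker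
  have hu : S.η x u = 0 := hu
  have hpol {v : TangentSpace I x} (hv : S.η x v = 0) : g.val x u v = 0 := by
    have h1 := h (u + v) (by rw [map_add, hu, hv, add_zero])
    simp only [map_add, add_apply, h u hu, h v hv, g.symm x v u] at h1
    linarith
  refine hu0 (g.nondegenerate x u fun v ↦ ?_)
  have h1 := hpol (v := v - S.η x v • S.ξ x) (by simp [S.η_ξ])
  rw [map_sub, map_smul, S.val_ξ, hu, mul_zero, smul_zero, sub_zero] at h1
  exact h1

/-- Near each point there is an adapted frame: the horizontal part of a smooth extension of a
non-null vector of `ker η` can be normalized. -/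
theorem exists_adaptedFrame (hE : 1 < Module.finrank ℝ E) (x : M) :
    ∃ (U : Set M) (_ : AdaptedFrame S U), x ∈ U := by
  obtain ⟨u, hu, hu0⟩ := S.exists_val_self_ne_zero hE x
  obtain ⟨δ, hδ, hδu⟩ : ∃ δ : ℝ, δ * δ = 1 ∧ 0 < δ * g.val x u u := by
    rcases hu0.lt_or_gt with h | h
    · exact ⟨-1, by norm_num, by linarith⟩
    · exact ⟨1, by norm_num, by linarith⟩
  obtain ⟨s, hs, hw⟩ := exists_contMDiffOn_extend (k := ∞) I E u
  obtain ⟨W, hWs, hW, hxW⟩ := mem_nhds_iff.1 hs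
  replace hw := hw.mono hWs
  -- the horizontal part of an extension of `u`, before normalization
  let h : ∀ y : M, TangentSpace I y := extend E u - (fun y ↦ S.η y (extend E u y)) • S.ξ
  have hh : CMDiff[W] ∞ (T% h) :=
    hw.sub_section ((ContMDiffOn.oneForm_apply S.contMDiff_η hw).smul_section
      S.contMDiff_ξ.contMDiffOn)
  have hηh (y : M) : S.η y (h y) = 0 := by simp [h, S.η_ξ]
  have hx : h x = u := by simp [h, hu]
  let r : M → ℝ := fun y ↦ δ * g.val y (h y) (h y)
  have hr : CMDiff[W] ∞ r := contMDiffOn_const.mul (g.contMDiffOn_val hh hh)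
  have hU : IsOpen (W ∩ r ⁻¹' Ioi 0) := hr.continuousOn.isOpen_inter_preimage hW isOpen_Ioi
  have hn : CMDiff[W ∩ r ⁻¹' Ioi 0] ∞ (fun y ↦ (√(r y))⁻¹) := by
    intro y hy
    have hy0 : 0 < r y := hy.2
    have h1 : ContDiffAt ℝ ∞ (fun t : ℝ ↦ (√t)⁻¹) (r y) :=
      (Real.contDiffAt_sqrt hy0.ne').inv (Real.sqrt_pos.2 hy0).ne'
    exact h1.contMDiffAt.comp_contMDiffWithinAt y ((hr.mono inter_subset_left) y hy)
  refine ⟨W ∩ r ⁻¹' Ioi 0, ⟨hU, (fun y ↦ (√(r y))⁻¹) • h,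
    hn.smul_section (hh.mono inter_subset_left), δ, hδ, fun y hy ↦ ?_, fun y _ ↦ ?_⟩, hxW, ?_⟩
  · have hy0 : 0 < r y := hy.2
    have hsq := Real.mul_self_sqrt hy0.le
    have hne := (Real.sqrt_pos.2 hy0).ne'
    simp only [Pi.smul_apply', map_smul, smul_apply, smul_eq_mul]
    field_simp
    rw [sq, hsq]
    simp only [r]
    linear_combination -(g.val y (h y) (h y)) * hδ
  · simp [hηh]
  · simpa [r, hx] using hδu

end Existence

end

theorem theorem6p7 {M : Type*} [TopologicalSpace M] [T2Space M] [SecondCountableTopology M]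
    [ChartedSpace (EuclideanSpace ℝ (Fin 3)) M] [IsManifold (𝓡 3) ∞ M]
    (g : PseudoRiemannianMetric (𝓡 3) M) (ε : ℝ)
    (S : AlmostContactPseudoMetricStructure g ε) (hS : S.IsKenmotsu)
    (V : ∀ x : M, TangentSpace (𝓡 3) x) (l : ℝ) (hV : g.IsRicciSoliton V l) :
    g.HasConstantCurvature (-ε) ∧
      ∀ (x : M) (u v : TangentSpace (𝓡 3) x),
        g.val x u u * g.val x v v - g.val x u v ^ 2 ≠ 0 → g.sectionalCurvature x u v = -ε := by
  have hE : Module.finrank ℝ (EuclideanSpace ℝ (Fin 3)) = 3 := finrank_euclideanSpace_fin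
  have : Fact (Module.finrank ℝ (EuclideanSpace ℝ (Fin 3)) = 3) := ⟨hE⟩
  have hR : g.HasConstantCurvature (-ε) := fun x u v w ↦ by
    obtain ⟨U, F, hx⟩ := exists_adaptedFrame S (by rw [hE]; norm_num) x
    rw [F.curvature_eq hS hx, F.curv_eq_zero hS hV]
    simp
  refine ⟨hR, fun x u v h ↦ ?_⟩
  rw [PseudoRiemannianMetric.sectionalCurvature, hR x u v v, div_eq_iff h]
  simp only [map_smul, map_sub, smul_apply, sub_apply, smul_eq_mul, g.symm x v u]
  ring
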